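/- Let $(M,g)$ be a compact smooth Riemannian manifold without boundary, of dimension $n$, with Levi-Civita connection $\nabla$, scalar curvature $R$ and Riemannian volume measure $dV$. Let $f$ be a smooth function on $M$, $A$ a smooth one-form and $B$ a smooth two-form on $M$, and put $F=dA$, $H=dB$, i.e. $F_{ij}=\partial_iA_j-\partial_jA_i$ and $H_{ijk}=\partial_iB_{jk}+\partial_jB_{ki}+\partial_kB_{ij}$. For a real constant $\chi$ consider the functional $$S(g,f,A,B)=\int_M e^{-f}\Big(-\chi+R+|\nabla f|^2-\tfrac1{12}H^2-\tfrac12F^2\Big)\,dV,\qquad F^2=F_{ij}F^{ij},\quad H^2=H_{ijk}H^{ijk}.$$ Call $(g,f,A,B)$ a critical point of $S$ if $\frac{d}{dt}\big|_{t=0}S(g+th,f+t\varphi,A+ta,B+tb)=0$ for every smooth symmetric two-tensor $h$, smooth function $\varphi$, smooth one-form $a$ and smooth two-form $b$ on $M$. Then: 1. if $\nabla_k(F_i{}^{k}e^{-f})=0$ on $M$, then $F=0$; 2. if $\nabla_k(H^{k}{}_{ij}e^{-f})=0$ on $M$, then $H=0$; 3. if $(g,f,A,B)$ is a critical point of $S$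 for some constant $\chi$, then $\nabla_k(F_i{}^{k}e^{-f})=0$ and $\nabla_k(H^{k}{}_{ij}e^{-f})=0$ on $M$, and $F=0$ and $H=0$. -/

import Mathlib

open scoped Manifold ContDiff
open MeasureTheory Bundle

noncomputable section

namespace SigmaModel

/-- The model space `ℝⁿ`. -/
abbrev Model (n : ℕ) := EuclideanSpace ℝ (Fin n)

/-- Fields of bilinear forms on the tangent spaces of `M`, no regularity imposed. -/
abbrev BilinField (n : ℕ) (M : Type*) [TopologicalSpace M] [ChartedSpace (Model n) M] :=
  ∀ x : M, TangentSpace (𝓡 n) x →L[ℝ] TangentSpace (𝓡 n) x →L[ℝ] ℝ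

/-- Differential forms of degree `k` on `M`, no regularity imposed. -/
abbrev FormField (n : ℕ) (M : Type*) [TopologicalSpace M] [ChartedSpace (Model n) M] (k : ℕ) :=
  ∀ x : M, TangentSpace (𝓡 n) x [⋀^Fin k]→L[ℝ] ℝ

/-- Smooth Riemannian metrics on `M`. -/
abbrev RMetric (n : ℕ) (M : Type*) [TopologicalSpace M] [ChartedSpace (Model n) M]
    [IsManifold (𝓡 n) ∞ M] :=
  ContMDiffRiemannianMetric (𝓡 n) ∞ (Model n) (fun x : M => TangentSpace (𝓡 n) x)

section Coordinates

variable {n : ℕ} {M : Type*} [TopologicalSpace M] [ChartedSpace (Model n) M]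

/-- The partial derivative `∂φ/∂yⁱ`. -/
def pd (i : Fin n) (φ : Model n → ℝ) (y : Model n) : ℝ :=
  fderiv ℝ φ y (EuclideanSpace.single i (1 : ℝ))

/-- The coordinate vector `∂/∂yⁱ` of the chart `e`, at the point with coordinates `y`. -/
def frame (e : OpenPartialHomeomorph M (Model n)) (y : Model n) (i : Fin n) :
    TangentSpace (𝓡 n) (e.symm y) :=
  mfderiv (𝓡 n) (𝓡 n) e.symm y (EuclideanSpace.single i (1 : ℝ))

/-- The matrix `(g_{ij})` of the components of `g` in the chart `e`. -/
def metricCoord (g : BilinField n M) (e : OpenPartialHomeomorph M (Model n)) (y : Model n) :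
    Matrix (Fin n) (Fin n) ℝ :=
  Matrix.of fun i j => g (e.symm y) (frame e y i) (frame e y j)

/-- The components `g^{ij}` of the inverse metric in the chart `e`. -/
def inverseCoord (g : BilinField n M) (e : OpenPartialHomeomorph M (Model n)) (y : Model n) :
    Matrix (Fin n) (Fin n) ℝ :=
  (metricCoord g e y)⁻¹

/-- The component `α_{a₁…a_k} = α(∂_{a₁}, …, ∂_{a_k})` of the form `α` in the chart `e`. -/
def formCoord {k : ℕ} (α : FormField n M k) (e : OpenPartialHomeomorph M (Model n)) (y : Model n)
    (a : Fin k → Fin n) : ℝ :=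
  α (e.symm y) (fun s => frame e y (a s))

/-- The form on `ℝⁿ` that represents `α` in the chart `e` (its pullback by `e⁻¹`); it is
meaningful on `e.target`. -/
def formRep {k : ℕ} (e : OpenPartialHomeomorph M (Model n)) (α : FormField n M k)
    (y : Model n) : Model n [⋀^Fin k]→L[ℝ] ℝ :=
  (α (e.symm y)).compContinuousLinearMap (mfderiv (𝓡 n) (𝓡 n) e.symm y)

/-- Smoothness of a differential form: its representative in each chart is smooth. -/
def IsSmoothForm {k : ℕ} (α : FormField n M k) : Prop :=
  ∀ e ∈ atlas (Model n) M, ContDiffOn ℝ ∞ (formRep e α) e.target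

/-- The exterior derivative `dα`, computed in the preferred chart at each point and pulled back
to `M`.  Thus `(dA)_{ij} = ∂_i A_j - ∂_j A_i` for one-forms and
`(dB)_{ijk} = ∂_i B_{jk} + ∂_j B_{ki} + ∂_k B_{ij}` for two-forms. -/
def extD {k : ℕ} (α : FormField n M k) : FormField n M (k + 1) := fun x =>
  (extDeriv (formRep (chartAt (Model n) x) α) (chartAt (Model n) x x)).compContinuousLinearMap
    (mfderiv (𝓡 n) (𝓡 n) (chartAt (Model n) x) x)

/-- The Christoffel symbols `Γ^k_{ij}` of the Levi-Civita connection. -/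
def christoffel (g : BilinField n M) (e : OpenPartialHomeomorph M (Model n)) (k i j : Fin n)
    (y : Model n) : ℝ :=
  1 / 2 * ∑ l, inverseCoord g e y k l *
    (pd i (fun z => metricCoord g e z j l) y + pd j (fun z => metricCoord g e z i l) y
      - pd l (fun z => metricCoord g e z i j) y)

/-- The curvature components
`R^k_{ijl} = ∂_i Γ^k_{jl} - ∂_j Γ^k_{il} + Γ^k_{ip} Γ^p_{jl} - Γ^k_{jp} Γ^p_{il}`. -/
def riemannCoord (g : BilinField n M) (e : OpenPartialHomeomorph M (Model n)) (k i j l : Fin n)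
    (y : Model n) : ℝ :=
  pd i (christoffel g e k j l) y - pd j (christoffel g e k i l) y
    + ∑ p, (christoffel g e k i p y * christoffel g e p j l y
      - christoffel g e k j p y * christoffel g e p i l y)

/-- The Ricci components `R_{ik} = g^{jl} R_{ijkl}`, where `R_{ijkl} = g_{kp} R^p_{ijl}`. -/
def ricciCoord (g : BilinField n M) (e : OpenPartialHomeomorph M (Model n)) (i k : Fin n)
    (y : Model n) : ℝ :=
  ∑ j, ∑ l, inverseCoord g e y j l * ∑ p, metricCoord g e y k p * riemannCoord g e p i j l y

/-- The scalar curvature `R = g^{ij} R_{ij}` at a point of `M`. -/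
def scalarCurvature (g : BilinField n M) (x : M) : ℝ :=
  let e := chartAt (Model n) x
  ∑ i, ∑ j, inverseCoord g e (e x) i j * ricciCoord g e i j (e x)

/-- `|∇f|² = g^{ij} ∂_i f ∂_j f` at a point of `M`. -/
def gradSq (g : BilinField n M) (f : M → ℝ) (x : M) : ℝ :=
  let e := chartAt (Model n) x
  ∑ i, ∑ j, inverseCoord g e (e x) i j
    * (pd i (fun z => f (e.symm z)) (e x) * pd j (fun z => f (e.symm z)) (e x))

/-- The full contraction `α_{a₁…a_k} α^{a₁…a_k}` at a point of `M`; it is `F² = F_{ij} F^{ij}` for a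
two-form and `H² = H_{ijk} H^{ijk}` for a three-form. -/
def formSq {k : ℕ} (g : BilinField n M) (α : FormField n M k) (x : M) : ℝ :=
  let e := chartAt (Model n) x
  ∑ a : Fin k → Fin n, ∑ b : Fin k → Fin n,
    (∏ s, inverseCoord g e (e x) (a s) (b s)) * (formCoord α e (e x) a * formCoord α e (e x) b)

/-- The components `F_i{}^k e^{-f}`, with `F_i{}^k = g^{kl} F_{il}`. -/
def weightedF (g : BilinField n M) (f : M → ℝ) (F : FormField n M 2)
    (e : OpenPartialHomeomorph M (Model n)) (i k : Fin n) (y : Model n) : ℝ :=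
  (∑ l, inverseCoord g e y k l * formCoord F e y ![i, l]) * Real.exp (-f (e.symm y))

/-- The component `∇_k (F_i{}^k e^{-f})` of the covariant divergence in the chart `e`, where
`∇_m T_i{}^k = ∂_m T_i{}^k + Γ^k_{mp} T_i{}^p - Γ^p_{mi} T_p{}^k`. -/
def divF (g : BilinField n M) (f : M → ℝ) (F : FormField n M 2)
    (e : OpenPartialHomeomorph M (Model n)) (i : Fin n) (y : Model n) : ℝ :=
  ∑ k, (pd k (weightedF g f F e i k) y
    + ∑ p, (christoffel g e k k p y * weightedF g f F e i p y
      - christoffel g e p k i y * weightedF g f F e p k y))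

/-- The components `H^k{}_{ij} e^{-f}`, with `H^k{}_{ij} = g^{kl} H_{lij}`. -/
def weightedH (g : BilinField n M) (f : M → ℝ) (H : FormField n M 3)
    (e : OpenPartialHomeomorph M (Model n)) (k i j : Fin n) (y : Model n) : ℝ :=
  (∑ l, inverseCoord g e y k l * formCoord H e y ![l, i, j]) * Real.exp (-f (e.symm y))

/-- The component `∇_k (H^k{}_{ij} e^{-f})` of the covariant divergence in the chart `e`, where
`∇_m T^k{}_{ij} = ∂_m T^k{}_{ij} + Γ^k_{mp} T^p{}_{ij} - Γ^p_{mi} T^k{}_{pj}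
- Γ^p_{mj} T^k{}_{ip}`. -/
def divH (g : BilinField n M) (f : M → ℝ) (H : FormField n M 3)
    (e : OpenPartialHomeomorph M (Model n)) (i j : Fin n) (y : Model n) : ℝ :=
  ∑ k, (pd k (weightedH g f H e k i j) y
    + ∑ p, (christoffel g e k k p y * weightedH g f H e p i j y
      - christoffel g e p k i y * weightedH g f H e k p j y
      - christoffel g e p k j y * weightedH g f H e k i p y))

/-- The equation `∇_k (F_i{}^k e^{-f}) = 0` on `M`, in all charts of the atlas. -/
def EquationF (g : BilinField n M) (f : M → ℝ) (F : FormField n M 2) : Prop :=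
  ∀ e ∈ atlas (Model n) M, ∀ y ∈ e.target, ∀ i, divF g f F e i y = 0

/-- The equation `∇_k (H^k{}_{ij} e^{-f}) = 0` on `M`, in all charts of the atlas. -/
def EquationH (g : BilinField n M) (f : M → ℝ) (H : FormField n M 3) : Prop :=
  ∀ e ∈ atlas (Model n) M, ∀ y ∈ e.target, ∀ i j, divH g f H e i j y = 0

end Coordinates

section Action

variable (n : ℕ) (M : Type*) [TopologicalSpace M] [ChartedSpace (Model n) M]
  [IsManifold (𝓡 n) ∞ M] [CompactSpace M] [T2Space M]

/-- A smooth partition of unity on `M` subordinate to the domains of the preferred charts. -/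
def chartPartition : SmoothPartitionOfUnity M (𝓡 n) M Set.univ :=
  (SmoothPartitionOfUnity.exists_isSubordinate_chartAt_source (𝓡 n) M).choose

theorem chartPartition_isSubordinate :
    (chartPartition n M).IsSubordinate (fun x => (chartAt (Model n) x).source) :=
  (SmoothPartitionOfUnity.exists_isSubordinate_chartAt_source (𝓡 n) M).choose_spec

variable {n M}
variable [MeasurableSpace M]

/-- The Riemannian volume measure `dV = √(det g_{ij}) dy¹ … dyⁿ`, glued from the charts by a
partition of unity.  By the change of variables formula it does not depend on the partition. -/
def volumeMeasure (g : BilinField n M) : Measure M :=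
  Measure.sum fun c : M =>
    (((volume : Measure (Model n)).restrict (chartAt (Model n) c).target).withDensity fun y =>
      ENNReal.ofReal (chartPartition n M c ((chartAt (Model n) c).symm y)
        * Real.sqrt (metricCoord g (chartAt (Model n) c) y).det)).map (chartAt (Model n) c).symm

/-- The functional
`S(g, f, A, B) = ∫ e^{-f} (-χ + R + |∇f|²) dV - 1/12 ∫ e^{-f} H² dV - 1/2 ∫ e^{-f} F² dV`,
where `F = dA` and `H = dB`. -/
def action (χ : ℝ) (g : BilinField n M) (f : M → ℝ) (A : FormField n M 1) (B : FormField n M 2) :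
    ℝ :=
  (∫ x, Real.exp (-f x) * (-χ + scalarCurvature g x + gradSq g f x) ∂(volumeMeasure g))
    - 1 / 12 * (∫ x, Real.exp (-f x) * formSq g (extD B) x ∂(volumeMeasure g))
    - 1 / 2 * (∫ x, Real.exp (-f x) * formSq g (extD A) x ∂(volumeMeasure g))

/-- `(g, f, A, B)` is a critical point of `S`: the first variation of `S` vanishes in the direction
of every smooth symmetric two-tensor `h`, smooth function `φ`, smooth one-form `a` and smooth
two-form `b`. -/
def IsCritical (χ : ℝ) (g : BilinField n M) (f : M → ℝ) (A : FormField n M 1)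
    (B : FormField n M 2) : Prop :=
  ∀ (h : BilinField n M) (φ : M → ℝ) (a : FormField n M 1) (b : FormField n M 2),
    (∀ x v w, h x v w = h x w v) →
    ContMDiff (𝓡 n) ((𝓡 n).prod 𝓘(ℝ, Model n →L[ℝ] Model n →L[ℝ] ℝ)) ∞
      (fun x => TotalSpace.mk' (Model n →L[ℝ] Model n →L[ℝ] ℝ)
        (E := fun x : M => TangentSpace (𝓡 n) x →L[ℝ] TangentSpace (𝓡 n) x →L[ℝ] ℝ) x (h x)) →
    ContMDiff (𝓡 n) 𝓘(ℝ, ℝ) ∞ φ → IsSmoothForm a → IsSmoothForm b →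
    HasDerivAt (fun t : ℝ => action χ (fun x => g x + t • h x) (fun x => f x + t * φ x)
      (fun x => A x + t • a x) (fun x => B x + t • b x)) 0 0

end Action

end SigmaModel

end

open SigmaModel

/-!
The equations for `F` and `H` are handled by one statement about a smooth `m`-form `α`, with
`m = 1, 2`: if the weighted divergence of `dα` vanishes, then `∫ e^{-f} |dα|² dV = 0`, hence
`dα = 0`. The weighted divergence is, up to a factor, the formal adjoint of `d`, so the integral
`⟨dα, dα⟩` is a multiple of `⟨div dα, α⟩ = 0`. To avoid a general divergence theorem on `M`, `α` is
written as `∑ ρ_c α` with the partition of unity that defines the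
volume measure. Each `ρ_c α` is compactly supported in one chart, and
`∫ e^{-f} ⟨dα, d(ρ_c α)⟩ dV` becomes an integral over `ℝⁿ`
(`setIntegral_contract_extDeriv_eq_zero`, `integral_formSq_extD_eq_zero`).

In coordinates the argument rests on the identity
`∂_k (√g u Φ^{k a₁…aₘ}) = √g g^{a₁b₁} ⋯ g^{aₘbₘ} ∇_k (u Φ^k{}_{b₁…bₘ})`
for alternating `Φ` (`sum_pd_sqrt_det_mul_raised`), which combines Jacobi's formula for
`∂_k √g` with the formula for `∂_k g^{ij}` in terms of Christoffel symbols. The equations `divF` and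
`divH` are instances of its right-hand side (`divF_eq`, `divH_eq`).

The passage between charts uses that full contractions are tensorial (`contract_change`), that `d`
commutes with pullback (`formRep_extD`), and that by the change of variables formula the volume
measure restricts to `√g dy` on the domain of each preferred chart
(`volumeMeasure_apply_of_subset`). The volume measure is finite and positive on open sets, so a
continuous nonnegative function with zero integral vanishes (`eq_zero_of_integral_formSq`).

At a critical point it suffices to vary `A` in the direction of `A` itself: the action becomes
`C - ½ (1 + t)² ∫ e^{-f} F² dV`, whose derivative at `0` is minus the integral. The
integral is therefore zero, so `F = 0` and the equation for `F` holds trivially. The same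
variation of `B` gives `H = 0`.
-/

namespace SigmaModel

/-! ### Full contractions of covariant tensors -/

/-- The full contraction `P^{a₁b₁} ⋯ P^{aₖbₖ} θ_{a₁…aₖ} η_{b₁…bₖ}` of two arrays of components. -/
noncomputable def contract {n k : ℕ} (P : Matrix (Fin n) (Fin n) ℝ) (θ η : (Fin k → Fin n) → ℝ) :
    ℝ :=
  ∑ a, ∑ b, (∏ s, P (a s) (b s)) * (θ a * η b)

/-- The linear change of variables `θ_a ↦ J^{c₁}_{a₁} ⋯ J^{cₖ}_{aₖ} θ_c` on arrays. -/
noncomputable def pullArray {n k : ℕ} (J : Matrix (Fin n) (Fin n) ℝ) (θ : (Fin k → Fin n) → ℝ)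
    (a : Fin k → Fin n) : ℝ :=
  ∑ c, (∏ s, J (c s) (a s)) * θ c

theorem prod_mul_apply {n k : ℕ} (P Q : Matrix (Fin n) (Fin n) ℝ) (a b : Fin k → Fin n) :
    ∑ c : Fin k → Fin n, (∏ s, P (a s) (c s)) * ∏ s, Q (c s) (b s)
      = ∏ s, (P * Q) (a s) (b s) := by
  simp_rw [← Finset.prod_mul_distrib, Matrix.mul_apply]
  rw [Finset.prod_univ_sum, Fintype.piFinset_univ]

theorem pullArray_pullArray {n k : ℕ} (J K : Matrix (Fin n) (Fin n) ℝ)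
    (θ : (Fin k → Fin n) → ℝ) : pullArray K (pullArray J θ) = pullArray (J * K) θ := by
  funext a
  simp only [pullArray, Finset.mul_sum]
  rw [Finset.sum_comm]
  refine Finset.sum_congr rfl fun c _ => ?_
  rw [← prod_mul_apply, Finset.sum_mul]
  exact Finset.sum_congr rfl fun d _ => by ring

theorem pullArray_one {n k : ℕ} (θ : (Fin k → Fin n) → ℝ) : pullArray 1 θ = θ := by
  funext a
  rw [pullArray, Finset.sum_eq_single a]
  · simp
  · intro c _ hc
    obtain ⟨s, hs⟩ := Function.ne_iff.1 hc
    rw [Finset.prod_eq_zero (Finset.mem_univ s) (by exact Matrix.one_apply_ne hs), zero_mul]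
  · simp

theorem contract_eq_sum_pullArray {n k : ℕ} (P : Matrix (Fin n) (Fin n) ℝ)
    (θ η : (Fin k → Fin n) → ℝ) : contract P θ η = ∑ b, pullArray P θ b * η b := by
  simp only [contract, pullArray, Finset.sum_mul]
  rw [Finset.sum_comm]
  exact Finset.sum_congr rfl fun b _ => Finset.sum_congr rfl fun a _ => by ring

theorem sum_pullArray_mul {n k : ℕ} (J : Matrix (Fin n) (Fin n) ℝ)
    (θ η : (Fin k → Fin n) → ℝ) :
    ∑ b, θ b * pullArray J η b = ∑ c, pullArray J.transpose θ c * η c := by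
  simp only [pullArray, Finset.sum_mul, Finset.mul_sum, Matrix.transpose_apply]
  rw [Finset.sum_comm]
  exact Finset.sum_congr rfl fun b _ => Finset.sum_congr rfl fun a _ => by ring

/-- Contraction is tensorial: changing the frame by `J` amounts to changing the inverse metric
by `J`. -/
theorem contract_pullArray {n k : ℕ} (P J : Matrix (Fin n) (Fin n) ℝ)
    (θ η : (Fin k → Fin n) → ℝ) :
    contract P (pullArray J θ) (pullArray J η) = contract (J * P * J.transpose) θ η := by
  rw [contract_eq_sum_pullArray, contract_eq_sum_pullArray, sum_pullArray_mul,
    pullArray_pullArray, pullArray_pullArray, Matrix.mul_assoc]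

theorem contract_one {n k : ℕ} (θ : (Fin k → Fin n) → ℝ) :
    contract 1 θ θ = ∑ a, θ a ^ 2 := by
  rw [contract_eq_sum_pullArray, pullArray_one]
  exact Finset.sum_congr rfl fun b _ => by ring

open scoped MatrixOrder in
theorem exists_contract_eq_sum_sq {n : ℕ} (k : ℕ) {P : Matrix (Fin n) (Fin n) ℝ}
    (hP : P.PosDef) : ∃ S : Matrix (Fin n) (Fin n) ℝ, IsUnit S.det ∧
      ∀ θ : (Fin k → Fin n) → ℝ, contract P θ θ = ∑ a, pullArray S θ a ^ 2 := by
  obtain ⟨B, hB⟩ := CStarAlgebra.nonneg_iff_eq_star_mul_self.mp hP.posSemidef.nonneg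
  rw [Matrix.star_eq_conjTranspose, Matrix.conjTranspose_eq_transpose_of_trivial] at hB
  refine ⟨B.transpose, ?_, fun θ => ?_⟩
  · have h := hP.det_pos
    rw [hB, Matrix.det_mul] at h
    exact isUnit_iff_ne_zero.2 (left_ne_zero_of_mul h.ne')
  · rw [← contract_one, contract_pullArray, Matrix.mul_one, Matrix.transpose_transpose, ← hB]

theorem contract_self_nonneg {n k : ℕ} {P : Matrix (Fin n) (Fin n) ℝ} (hP : P.PosDef)
    (θ : (Fin k → Fin n) → ℝ) : 0 ≤ contract P θ θ := by
  obtain ⟨S, -, hS⟩ := exists_contract_eq_sum_sq k hP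
  rw [hS]
  exact Finset.sum_nonneg fun a _ => sq_nonneg _

theorem eq_zero_of_contract_self {n k : ℕ} {P : Matrix (Fin n) (Fin n) ℝ} (hP : P.PosDef)
    {θ : (Fin k → Fin n) → ℝ} (h : contract P θ θ = 0) : θ = 0 := by
  obtain ⟨S, hu, hS⟩ := exists_contract_eq_sum_sq k hP
  rw [hS, Finset.sum_eq_zero_iff_of_nonneg fun a _ => sq_nonneg _] at h
  have h0 : pullArray S θ = 0 := funext fun a => by simpa using h a (Finset.mem_univ a)
  rw [← pullArray_one θ, ← Matrix.mul_nonsing_inv S hu, ← pullArray_pullArray, h0]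
  funext a
  simp [pullArray]

theorem contract_sum_right {n k : ℕ} {ι : Type*} (s : Finset ι) (P : Matrix (Fin n) (Fin n) ℝ)
    (θ : (Fin k → Fin n) → ℝ) (η : ι → (Fin k → Fin n) → ℝ) :
    contract P θ (fun b => ∑ c ∈ s, η c b) = ∑ c ∈ s, contract P θ (η c) := by
  simp only [contract_eq_sum_pullArray, Finset.mul_sum]
  rw [Finset.sum_comm]

theorem contract_zero_right {n k : ℕ} (P : Matrix (Fin n) (Fin n) ℝ)
    (θ : (Fin k → Fin n) → ℝ) : contract P θ 0 = 0 := by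
  simp [contract]

/-- The components of an alternating form on `ℝⁿ` in the standard basis. -/
noncomputable def comps {n k : ℕ} (θ : Model n [⋀^Fin k]→L[ℝ] ℝ) (a : Fin k → Fin n) : ℝ :=
  θ fun s => EuclideanSpace.single (a s) (1 : ℝ)

theorem apply_sum_single {n k : ℕ} (θ : Model n [⋀^Fin k]→L[ℝ] ℝ)
    (J : Fin k → Fin n → ℝ) :
    θ (fun s => ∑ i, J s i • EuclideanSpace.single i (1 : ℝ))
      = ∑ c : Fin k → Fin n, (∏ s, J s (c s)) * comps θ c := by
  have h := (θ.toContinuousMultilinearMap.toMultilinearMap).map_sum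
    (fun s i => J s i • EuclideanSpace.single i (1 : ℝ))
  refine h.trans (Finset.sum_congr rfl fun c _ => ?_)
  exact (θ.toContinuousMultilinearMap.toMultilinearMap).map_smul_univ _ _

theorem sum_smul_single {n : ℕ} (v : Model n) :
    ∑ i, v i • EuclideanSpace.single i (1 : ℝ) = v := by
  ext j
  simp [Finset.sum_apply, Pi.single_apply]

theorem eq_zero_of_comps_eq_zero {n k : ℕ} {θ : Model n [⋀^Fin k]→L[ℝ] ℝ}
    (h : comps θ = 0) : θ = 0 := by
  ext v
  have h1 := apply_sum_single θ (fun s i => v s i)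
  simp only [sum_smul_single, h, Pi.zero_apply, mul_zero, Finset.sum_const_zero] at h1
  exact h1

/-- The matrix of a linear map in the standard basis. -/
noncomputable def stdMatrix {n : ℕ} (L : Model n →L[ℝ] Model n) : Matrix (Fin n) (Fin n) ℝ :=
  Matrix.of fun i j => L (EuclideanSpace.single j 1) i

theorem det_stdMatrix {n : ℕ} (L : Model n →L[ℝ] Model n) : (stdMatrix L).det = L.det := by
  have h : stdMatrix L = LinearMap.toMatrix (EuclideanSpace.basisFun (Fin n) ℝ).toBasis
      (EuclideanSpace.basisFun (Fin n) ℝ).toBasis (L : Model n →ₗ[ℝ] Model n) := by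
    ext i j
    simp [stdMatrix, LinearMap.toMatrix_apply]
  rw [h, LinearMap.det_toMatrix]

theorem comps_compContinuousLinearMap {n k : ℕ} (θ : Model n [⋀^Fin k]→L[ℝ] ℝ)
    (L : Model n →L[ℝ] Model n) :
    comps (θ.compContinuousLinearMap L) = pullArray (stdMatrix L) (comps θ) := by
  funext a
  have h := apply_sum_single θ (fun s i => stdMatrix L i (a s))
  rw [pullArray, ← h, comps]
  change θ _ = θ _
  congr 1
  funext s
  exact (sum_smul_single (L (EuclideanSpace.single (a s) 1))).symm

/-! ### Calculus in coordinates -/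

section PartialDerivatives

variable {n : ℕ}

theorem pd_congr {i : Fin n} {φ ψ : Model n → ℝ} {y : Model n} (h : φ =ᶠ[nhds y] ψ) :
    pd i φ y = pd i ψ y := by
  rw [pd, h.fderiv_eq, pd]

theorem pd_const (i : Fin n) (c : ℝ) (y : Model n) : pd i (fun _ => c) y = 0 := by
  simp [pd]

theorem pd_neg (i : Fin n) (φ : Model n → ℝ) (y : Model n) :
    pd i (fun z => -φ z) y = -pd i φ y := by
  simp [pd]

theorem pd_mul (i : Fin n) {φ ψ : Model n → ℝ} {y : Model n} (hφ : DifferentiableAt ℝ φ y)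
    (hψ : DifferentiableAt ℝ ψ y) :
    pd i (fun z => φ z * ψ z) y = pd i φ y * ψ y + φ y * pd i ψ y := by
  simp only [pd, fderiv_fun_mul hφ hψ, add_apply, smul_apply, smul_eq_mul]
  ring

theorem pd_sum (i : Fin n) {ι : Type*} {s : Finset ι} {φ : ι → Model n → ℝ} {y : Model n}
    (hφ : ∀ a ∈ s, DifferentiableAt ℝ (φ a) y) :
    pd i (fun z => ∑ a ∈ s, φ a z) y = ∑ a ∈ s, pd i (φ a) y := by
  simp only [pd, fderiv_fun_sum hφ, sum_apply]

theorem pd_prod (i : Fin n) {ι : Type*} [DecidableEq ι] {s : Finset ι} {φ : ι → Model n → ℝ}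
    {y : Model n} (hφ : ∀ a ∈ s, DifferentiableAt ℝ (φ a) y) :
    pd i (fun z => ∏ a ∈ s, φ a z) y
      = ∑ a ∈ s, (∏ b ∈ s.erase a, φ b y) * pd i (φ a) y := by
  have h := HasFDerivAt.finsetProd (u := s) (g := φ) (x := y)
    (g' := fun a => fderiv ℝ (φ a) y) (fun a ha => (hφ a ha).hasFDerivAt)
  simp only [pd, h.fderiv, sum_apply, smul_apply, smul_eq_mul]

theorem contDiffAt_det {E : Type*} [NormedAddCommGroup E] [NormedSpace ℝ E] {r : WithTop ℕ∞}
    {G : E → Matrix (Fin n) (Fin n) ℝ} {y : E} (hG : ∀ i j, ContDiffAt ℝ r (fun z => G z i j) y) :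
    ContDiffAt ℝ r (fun z => (G z).det) y := by
  simp only [Matrix.det_apply']
  exact ContDiffAt.sum fun σ _ => contDiffAt_const.mul (contDiffAt_prod fun i _ => hG _ _)

theorem contDiffAt_inv_apply {E : Type*} [NormedAddCommGroup E] [NormedSpace ℝ E]
    {r : WithTop ℕ∞} {G : E → Matrix (Fin n) (Fin n) ℝ} {y : E}
    (hG : ∀ i j, ContDiffAt ℝ r (fun z => G z i j) y) (hdet : (G y).det ≠ 0) (i j : Fin n) :
    ContDiffAt ℝ r (fun z => (G z)⁻¹ i j) y := by
  simp only [Matrix.inv_def, Matrix.smul_apply, Ring.inverse_eq_inv', smul_eq_mul,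
    Matrix.adjugate_apply]
  refine ((contDiffAt_det hG).inv hdet).mul (contDiffAt_det fun k l => ?_)
  by_cases h : k = j
  · subst h
    simpa using contDiffAt_const
  · simpa [Matrix.updateRow_ne h] using hG k l

/-- Jacobi's formula. -/
theorem pd_det {G : Model n → Matrix (Fin n) (Fin n) ℝ} {y : Model n}
    (hG : ∀ i j, DifferentiableAt ℝ (fun z => G z i j) y) (hdet : (G y).det ≠ 0) (k : Fin n) :
    pd k (fun z => (G z).det) y
      = (G y).det * ∑ i, ∑ j, (G y)⁻¹ i j * pd k (fun z => G z j i) y := by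
  let D : (Fin n → Fin n → ℝ) → ℝ := fun N => (Matrix.of N).det
  have hD : ∀ N, DifferentiableAt ℝ D N := by
    intro N
    refine (contDiffAt_det (r := 1) fun i j => ?_).differentiableAt one_ne_zero
    exact (contDiff_apply_apply ℝ ℝ i j).contDiffAt
  have hG' : DifferentiableAt ℝ (fun z i j => G z i j) y :=
    differentiableAt_pi.2 fun i => differentiableAt_pi.2 fun j => hG i j
  let N : Matrix (Fin n) (Fin n) ℝ := Matrix.of fun i j => pd k (fun z => G z i j) y
  have hN : fderiv ℝ (fun z i j => G z i j) y (EuclideanSpace.single k 1) = fun i j => N i j := by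
    funext i j
    rw [fderiv_pi fun i => differentiableAt_pi.2 fun j => hG i j]
    simp only [ContinuousLinearMap.coe_pi']
    rw [fderiv_pi fun j => hG i j]
    rfl
  have h1 : pd k (fun z => (G z).det) y = fderiv ℝ D (fun i j => G y i j) (fun i j => N i j) := by
    rw [← hN]
    exact congrArg (fun L => L (EuclideanSpace.single k (1 : ℝ)))
      (fderiv_comp y (hD _) hG')
  -- along the line `G + t N` the determinant is `det G * det (1 + t G⁻¹ N)`
  have h2 : HasDerivAt (fun t : ℝ => D ((fun i j => G y i j) + t • fun i j => N i j))
      (fderiv ℝ D (fun i j => G y i j) (fun i j => N i j)) 0 := by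
    have := (hD (fun i j => G y i j)).hasFDerivAt.hasLineDerivAt (fun i j => N i j)
    exact this
  have h3 : HasDerivAt (fun t : ℝ => D ((fun i j => G y i j) + t • fun i j => N i j))
      ((G y).det * ((G y)⁻¹ * N).trace) 0 := by
    have hfac : (fun t : ℝ => D ((fun i j => G y i j) + t • fun i j => N i j))
        = fun t => (G y).det * (1 + ((G y)⁻¹ * N).trace * t
          + (Polynomial.divX (Polynomial.divX (Matrix.det
            (1 + (Polynomial.X : Polynomial ℝ) • ((G y)⁻¹ * N).map Polynomial.C)))).eval t
              * t ^ 2) := by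
      funext t
      rw [← Matrix.det_one_add_smul, ← Matrix.det_mul, Matrix.mul_add, Matrix.mul_one,
        Matrix.mul_smul, Matrix.mul_nonsing_inv_cancel_left _ _ (isUnit_iff_ne_zero.2 hdet)]
      rfl
    rw [hfac]
    have ha : HasDerivAt (fun t : ℝ => ((G y)⁻¹ * N).trace * t) ((G y)⁻¹ * N).trace 0 := by
      simpa using (hasDerivAt_id (0 : ℝ)).const_mul ((G y)⁻¹ * N).trace
    have hb := (Polynomial.hasDerivAt (Polynomial.divX (Polynomial.divX (Matrix.det
      (1 + (Polynomial.X : Polynomial ℝ) • ((G y)⁻¹ * N).map Polynomial.C)))) (0 : ℝ)).mul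
      (hasDerivAt_pow 2 (0 : ℝ))
    have hc := (((ha.const_add 1).add hb).const_mul (G y).det)
    exact hc.congr_deriv (by simp)
  rw [h1, h2.unique h3]
  rfl

end PartialDerivatives

section Metric

variable {n : ℕ} {M : Type*} [TopologicalSpace M] [ChartedSpace (Model n) M]
  {g : BilinField n M} {e : OpenPartialHomeomorph M (Model n)} {y : Model n}

theorem inverseCoord_symm (hs : ∀ z, (metricCoord g e z).IsSymm) (z : Model n) (i j : Fin n) :
    inverseCoord g e z i j = inverseCoord g e z j i := by
  have h : (inverseCoord g e z).IsSymm := by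
    rw [inverseCoord, Matrix.IsSymm, Matrix.transpose_nonsing_inv, (hs z).eq]
  exact h.apply j i

theorem christoffel_symm (hs : ∀ z, (metricCoord g e z).IsSymm) (k i j : Fin n) :
    christoffel g e k i j y = christoffel g e k j i y := by
  simp only [christoffel]
  congr 1
  refine Finset.sum_congr rfl fun l _ => ?_
  have h : (fun z => metricCoord g e z i j) = fun z => metricCoord g e z j i :=
    funext fun z => (hs z).apply j i
  rw [h]
  ring

/-- `Γ^p_{pk}` is the logarithmic derivative of `√det g`. -/
theorem sum_christoffel (hs : ∀ z, (metricCoord g e z).IsSymm) (k : Fin n) :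
    ∑ p, christoffel g e p p k y
      = 1 / 2 * ∑ i, ∑ j, inverseCoord g e y i j * pd k (fun z => metricCoord g e z j i) y := by
  have hsw : ∀ i j, (fun z => metricCoord g e z i j) = fun z => metricCoord g e z j i :=
    fun i j => funext fun z => (hs z).apply j i
  simp only [christoffel, ← Finset.mul_sum, mul_sub, mul_add, Finset.sum_sub_distrib,
    Finset.sum_add_distrib]
  have h : ∑ p, ∑ l, inverseCoord g e y p l * pd l (fun z => metricCoord g e z p k) y
      = ∑ p, ∑ l, inverseCoord g e y p l * pd p (fun z => metricCoord g e z k l) y := by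
    rw [Finset.sum_comm]
    refine Finset.sum_congr rfl fun p _ => Finset.sum_congr rfl fun l _ => ?_
    rw [inverseCoord_symm hs, hsw]
  have h' : ∑ p, ∑ l, inverseCoord g e y p l * pd k (fun z => metricCoord g e z p l) y
      = ∑ p, ∑ l, inverseCoord g e y p l * pd k (fun z => metricCoord g e z l p) y :=
    Finset.sum_congr rfl fun p _ => Finset.sum_congr rfl fun l _ => by rw [hsw]
  linear_combination (1 / 2) * h' - (1 / 2) * h

theorem pd_sqrt_det (hs : ∀ z, (metricCoord g e z).IsSymm)
    (hd : ∀ i j, ContDiffAt ℝ 1 (fun z => metricCoord g e z i j) y)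
    (hdet : 0 < (metricCoord g e y).det) (k : Fin n) :
    pd k (fun z => Real.sqrt (metricCoord g e z).det) y
      = Real.sqrt (metricCoord g e y).det * ∑ p, christoffel g e p p k y := by
  have h1 := ((contDiffAt_det hd).differentiableAt one_ne_zero).hasFDerivAt.sqrt hdet.ne'
  have h2 := pd_det (fun i j => (hd i j).differentiableAt one_ne_zero) hdet.ne' k
  rw [pd] at h2
  rw [pd, h1.fderiv, smul_apply, h2, sum_christoffel hs, smul_eq_mul]
  have h3 : Real.sqrt (metricCoord g e y).det ≠ 0 := (Real.sqrt_pos.2 hdet).ne'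
  have h4 := Real.mul_self_sqrt hdet.le
  simp only [inverseCoord]
  generalize (∑ i, ∑ j, (metricCoord g e y)⁻¹ i j * pd k (fun z => metricCoord g e z j i) y) = x
  field_simp
  rw [sq, h4]

theorem contDiffAt_inverseCoord {r : WithTop ℕ∞}
    (hd : ∀ i j, ContDiffAt ℝ r (fun z => metricCoord g e z i j) y)
    (hdet : 0 < (metricCoord g e y).det) (i j : Fin n) :
    ContDiffAt ℝ r (fun z => inverseCoord g e z i j) y :=
  contDiffAt_inv_apply hd hdet.ne' i j

/-- The inverse metric is parallel: `∂_k g^{ia} = -Γ^i_{kp} g^{pa} - Γ^a_{kp} g^{ip}`. -/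
theorem pd_inverseCoord (hs : ∀ z, (metricCoord g e z).IsSymm)
    (hd : ∀ i j, ContDiffAt ℝ 1 (fun z => metricCoord g e z i j) y)
    (hdet : 0 < (metricCoord g e y).det) (k i a : Fin n) :
    pd k (fun z => inverseCoord g e z i a) y
      = -∑ p, (christoffel g e i k p y * inverseCoord g e y p a
        + christoffel g e a k p y * inverseCoord g e y i p) := by
  have hsw : ∀ i j, (fun z => metricCoord g e z i j) = fun z => metricCoord g e z j i :=
    fun i j => funext fun z => (hs z).apply j i
  let P := inverseCoord g e y
  let N : Matrix (Fin n) (Fin n) ℝ := Matrix.of fun i j => pd k (fun z => metricCoord g e z i j) y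
  let Q : Matrix (Fin n) (Fin n) ℝ := Matrix.of fun i j => pd k (fun z => inverseCoord g e z i j) y
  have hu : IsUnit (metricCoord g e y).det := isUnit_iff_ne_zero.2 hdet.ne'
  have hdP := fun i j => (contDiffAt_inverseCoord hd hdet i j).differentiableAt one_ne_zero
  have hdG := fun i j => (hd i j).differentiableAt one_ne_zero
  have h1 : Q * metricCoord g e y + P * N = 0 := by
    ext i j
    have hev : (fun z => ∑ l, inverseCoord g e z i l * metricCoord g e z l j)
        =ᶠ[nhds y] fun _ => (1 : Matrix (Fin n) (Fin n) ℝ) i j := by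
      filter_upwards [(contDiffAt_det hd).continuousAt.eventually_ne hdet.ne'] with z hz
      rw [← Matrix.mul_apply, inverseCoord, Matrix.nonsing_inv_mul _ (isUnit_iff_ne_zero.2 hz)]
    have h := pd_congr (i := k) hev
    rw [pd_const, pd_sum k (φ := fun l z => inverseCoord g e z i l * metricCoord g e z l j)
      fun l _ => (hdP i l).mul (hdG l j)] at h
    simp only [pd_mul k (hdP i _) (hdG _ j), Finset.sum_add_distrib] at h
    simpa [Matrix.mul_apply, Q, N, P] using h
  have h2 : Q = -(P * N * P) := by
    have h := congrArg (· * P) h1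
    simp only [Matrix.add_mul, Matrix.zero_mul, Matrix.mul_assoc Q] at h
    rw [show metricCoord g e y * P = 1 from Matrix.mul_nonsing_inv _ hu, Matrix.mul_one] at h
    exact eq_neg_of_add_eq_zero_left h
  have h3 := congrFun (congrFun h2 i) a
  change pd k (fun z => inverseCoord g e z i a) y = _ at h3
  rw [h3, Matrix.neg_apply, neg_inj]
  simp only [Matrix.mul_apply, Finset.sum_mul, christoffel, Finset.mul_sum,
    Finset.sum_add_distrib]
  have hswap : ∑ p, ∑ l, 1 / 2 * (inverseCoord g e y a l * (pd k (fun z => metricCoord g e z p l) y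
        + pd p (fun z => metricCoord g e z k l) y - pd l (fun z => metricCoord g e z k p) y))
          * inverseCoord g e y i p
      = ∑ p, ∑ l, 1 / 2 * (inverseCoord g e y p a * (pd k (fun z => metricCoord g e z p l) y
        + pd l (fun z => metricCoord g e z k p) y - pd p (fun z => metricCoord g e z k l) y))
          * inverseCoord g e y i l := by
    rw [Finset.sum_comm]
    refine Finset.sum_congr rfl fun p _ => Finset.sum_congr rfl fun l _ => ?_
    rw [inverseCoord_symm hs y a, hsw l p]
  rw [hswap, ← Finset.sum_add_distrib]
  refine Finset.sum_congr rfl fun p _ => ?_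
  rw [← Finset.sum_add_distrib]
  refine Finset.sum_congr rfl fun l _ => ?_
  simp only [P, N, Matrix.of_apply]
  rw [hsw p l]
  ring

end Metric

/-! ### The divergence of a weighted form in coordinates -/

section Divergence

variable {n m : ℕ} {M : Type*} [TopologicalSpace M] [ChartedSpace (Model n) M]
  {g : BilinField n M} {e : OpenPartialHomeomorph M (Model n)} {y : Model n}

/-- The components of a form with all indices raised by the inverse metric of `g`. -/
noncomputable def raised (g : BilinField n M) (e : OpenPartialHomeomorph M (Model n))
    (Φ : Model n → Model n [⋀^Fin m]→L[ℝ] ℝ) (c : Fin m → Fin n) (z : Model n) : ℝ :=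
  ∑ b, (∏ s, inverseCoord g e z (c s) (b s)) * comps (Φ z) b

/-- The components `u g^{kl} Φ_{l b₁…bₘ}` of a form with its first index raised, multiplied by a
weight `u`. -/
noncomputable def weighted (g : BilinField n M) (e : OpenPartialHomeomorph M (Model n))
    (u : Model n → ℝ) (Φ : Model n → Model n [⋀^Fin (m + 1)]→L[ℝ] ℝ) (k : Fin n)
    (b : Fin m → Fin n) (z : Model n) : ℝ :=
  (∑ l, inverseCoord g e z k l * comps (Φ z) (Fin.cons l b)) * u z

/-- The covariant divergence `∇_k T^k{}_{b₁…bₘ}` in the chart `e`. -/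
noncomputable def covDiv (g : BilinField n M) (e : OpenPartialHomeomorph M (Model n))
    (T : Fin n → (Fin m → Fin n) → Model n → ℝ) (b : Fin m → Fin n) (y : Model n) : ℝ :=
  ∑ k, (pd k (T k b) y + ∑ p, (christoffel g e k k p y * T p b y
    - ∑ s, christoffel g e p k (b s) y * T k (Function.update b s p) y))

theorem raised_eq_apply (Φ : Model n → Model n [⋀^Fin m]→L[ℝ] ℝ) (c : Fin m → Fin n)
    (z : Model n) : raised g e Φ c z
      = Φ z (fun s => ∑ i, inverseCoord g e z (c s) i • EuclideanSpace.single i (1 : ℝ)) :=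
  (apply_sum_single (Φ z) fun s i => inverseCoord g e z (c s) i).symm

theorem raised_cons_update (Φ : Model n → Model n [⋀^Fin (m + 1)]→L[ℝ] ℝ) (a : Fin m → Fin n)
    (s : Fin m) (k p : Fin n) (z : Model n) :
    raised g e Φ (Fin.cons k (Function.update a s p)) z
      = -raised g e Φ (Fin.cons p (Function.update a s k)) z := by
  rw [raised_eq_apply, raised_eq_apply]
  have h := (Φ z).toAlternatingMap.map_swap
    (fun t => ∑ i, inverseCoord g e z
      ((Fin.cons p (Function.update a s k) : Fin (m + 1) → Fin n) t) i
        • EuclideanSpace.single i (1 : ℝ)) (Fin.succ_ne_zero s).symm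
  refine Eq.trans ?_ h
  change Φ z _ = Φ z _
  congr 1
  funext t
  simp only [Function.comp_apply]
  congr 2
  funext i
  congr 2
  refine Fin.cases ?_ (fun t => ?_) t
  · simp
  · by_cases ht : t = s
    · subst ht; simp
    · rw [Equiv.swap_apply_of_ne_of_ne (Fin.succ_ne_zero t) (by simpa using ht)]
      simp [ht]

theorem raised_insertNth (Φ : Model n → Model n [⋀^Fin (m + 1)]→L[ℝ] ℝ) (i : Fin (m + 1))
    (k : Fin n) (a : Fin m → Fin n) (z : Model n) :
    (-1) ^ (i : ℕ) * raised g e Φ (i.insertNth k a) z = raised g e Φ (Fin.cons k a) z := by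
  rw [raised_eq_apply, raised_eq_apply]
  let r : Fin n → Model n := fun c =>
    ∑ i, inverseCoord g e z c i • EuclideanSpace.single i (1 : ℝ)
  have h := (Φ z).neg_one_pow_smul_map_insertNth i (r k) fun s => r (a s)
  have h1 : (fun s => r ((i.insertNth k a : Fin (m + 1) → Fin n) s))
      = i.insertNth (r k) fun s => r (a s) := by
    funext s
    refine Fin.succAboveCases i ?_ (fun t => ?_) s <;> simp
  have h2 : (fun s => r ((Fin.cons k a : Fin (m + 1) → Fin n) s))
      = Matrix.vecCons (r k) fun s => r (a s) := by
    funext s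
    refine Fin.cases ?_ (fun t => ?_) s <;> simp
  change (-1) ^ (i : ℕ) * Φ z (fun s => r _) = Φ z fun s => r _
  rw [h1, h2, ← h]
  simp

theorem mul_raised_cons (u : Model n → ℝ) (Φ : Model n → Model n [⋀^Fin (m + 1)]→L[ℝ] ℝ)
    (k : Fin n) (a : Fin m → Fin n) (z : Model n) :
    u z * raised g e Φ (Fin.cons k a) z
      = ∑ b : Fin m → Fin n, (∏ s, inverseCoord g e z (a s) (b s)) * weighted g e u Φ k b z := by
  rw [raised, ← (Fin.consEquiv fun _ => Fin n).sum_comp, Fintype.sum_prod_type,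
    Finset.sum_comm, Finset.mul_sum]
  refine Finset.sum_congr rfl fun b _ => ?_
  simp only [weighted, Finset.mul_sum, Finset.sum_mul]
  refine Finset.sum_congr rfl fun l _ => ?_
  change u z * ((∏ s, inverseCoord g e z ((Fin.cons k a : Fin (m + 1) → Fin n) s)
    ((Fin.cons l b : Fin (m + 1) → Fin n) s)) * comps (Φ z) (Fin.cons l b)) = _
  simp only [Fin.prod_univ_succ, Fin.cons_zero, Fin.cons_succ]
  ring

/-- Exchange of a summation index with the `s`-th entry of a multi-index. -/
theorem sum_update_comm (s : Fin m) (f : (Fin m → Fin n) → Fin n → ℝ) :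
    ∑ b : Fin m → Fin n, ∑ p, f (Function.update b s p) (b s) = ∑ b, ∑ p, f b p := by
  rw [← Fintype.sum_prod_type', ← Fintype.sum_prod_type']
  let σ : (Fin m → Fin n) × Fin n → (Fin m → Fin n) × Fin n :=
    fun q => (Function.update q.1 s q.2, q.1 s)
  have hσ : Function.Involutive σ := fun q => by simp [σ]
  exact Equiv.sum_comp (hσ.toPerm σ) fun q : (Fin m → Fin n) × Fin n => f q.1 q.2

theorem prod_update_left (P : Matrix (Fin n) (Fin n) ℝ) (a b : Fin m → Fin n) (s : Fin m)
    (p : Fin n) :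
    ∏ t, P (Function.update a s p t) (b t)
      = P p (b s) * ∏ t ∈ Finset.univ.erase s, P (a t) (b t) := by
  rw [← Finset.mul_prod_erase _ _ (Finset.mem_univ s), Function.update_self]
  congr 1
  exact Finset.prod_congr rfl fun t ht => by
    rw [Function.update_of_ne (Finset.ne_of_mem_erase ht)]

theorem prod_update_right (P : Matrix (Fin n) (Fin n) ℝ) (a b : Fin m → Fin n) (s : Fin m)
    (p : Fin n) :
    ∏ t, P (a t) (Function.update b s p t)
      = P (a s) p * ∏ t ∈ Finset.univ.erase s, P (a t) (b t) := by
  rw [← Finset.mul_prod_erase _ _ (Finset.mem_univ s), Function.update_self]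
  congr 1
  exact Finset.prod_congr rfl fun t ht => by
    rw [Function.update_of_ne (Finset.ne_of_mem_erase ht)]

theorem pd_prod_inverseCoord (hs : ∀ z, (metricCoord g e z).IsSymm)
    (hd : ∀ i j, ContDiffAt ℝ 1 (fun z => metricCoord g e z i j) y)
    (hdet : 0 < (metricCoord g e y).det) (k : Fin n) (a b : Fin m → Fin n) :
    pd k (fun z => ∏ s, inverseCoord g e z (a s) (b s)) y
      = -(∑ s, ∑ p, christoffel g e (a s) k p y
            * ∏ t, inverseCoord g e y (Function.update a s p t) (b t))
        - ∑ s, ∑ p, christoffel g e (b s) k p y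
            * ∏ t, inverseCoord g e y (a t) (Function.update b s p t) := by
  rw [pd_prod k (φ := fun s z => inverseCoord g e z (a s) (b s)) fun s _ =>
    (contDiffAt_inverseCoord hd hdet _ _).differentiableAt one_ne_zero]
  rw [← Finset.sum_neg_distrib, ← Finset.sum_sub_distrib]
  refine Finset.sum_congr rfl fun s _ => ?_
  simp only [pd_inverseCoord hs hd hdet, prod_update_left, prod_update_right,
    Finset.sum_add_distrib, mul_neg, mul_add, Finset.mul_sum, neg_add, sub_eq_add_neg]
  congr 2 <;> exact Finset.sum_congr rfl fun p _ => by ring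

theorem differentiableAt_weighted
    (hd : ∀ i j, ContDiffAt ℝ 1 (fun z => metricCoord g e z i j) y)
    (hdet : 0 < (metricCoord g e y).det) {u : Model n → ℝ} (hu : DifferentiableAt ℝ u y)
    {Φ : Model n → Model n [⋀^Fin (m + 1)]→L[ℝ] ℝ}
    (hΦ : ∀ c, DifferentiableAt ℝ (fun z => comps (Φ z) c) y) (k : Fin n) (b : Fin m → Fin n) :
    DifferentiableAt ℝ (weighted g e u Φ k b) y :=
  (DifferentiableAt.fun_sum fun l _ =>
    ((contDiffAt_inverseCoord hd hdet k l).differentiableAt one_ne_zero).mul (hΦ _)).mul hu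

/-- The divergence identity
`∂_k (√g u Φ^{k a₁…aₘ}) = √g g^{a₁b₁} ⋯ g^{aₘbₘ} ∇_k (u Φ^k{}_{b₁…bₘ})`. The Christoffel terms that
come from the derivatives of `g^{aᵢbᵢ}` either build up the covariant derivative or contract the
symmetric `Γ^{aᵢ}_{kp}` with two indices of the alternating `Φ`. -/
theorem sum_pd_sqrt_det_mul_raised (hs : ∀ z, (metricCoord g e z).IsSymm)
    (hd : ∀ i j, ContDiffAt ℝ 1 (fun z => metricCoord g e z i j) y)
    (hdet : 0 < (metricCoord g e y).det) {u : Model n → ℝ} (hu : DifferentiableAt ℝ u y)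
    {Φ : Model n → Model n [⋀^Fin (m + 1)]→L[ℝ] ℝ}
    (hΦ : ∀ c, DifferentiableAt ℝ (fun z => comps (Φ z) c) y) (a : Fin m → Fin n) :
    ∑ k, pd k (fun z => Real.sqrt (metricCoord g e z).det
        * (u z * raised g e Φ (Fin.cons k a) z)) y
      = Real.sqrt (metricCoord g e y).det * ∑ b : Fin m → Fin n,
          (∏ s, inverseCoord g e y (a s) (b s)) * covDiv g e (weighted g e u Φ) b y := by
  let W := weighted g e u Φ
  let V : Fin n → (Fin m → Fin n) → ℝ := fun k c => u y * raised g e Φ (Fin.cons k c) y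
  have hV : ∀ k c, V k c = ∑ b : Fin m → Fin n, (∏ s, inverseCoord g e y (c s) (b s)) * W k b y :=
    fun k c => mul_raised_cons u Φ k c y
  have hP : ∀ b : Fin m → Fin n,
      DifferentiableAt ℝ (fun z => ∏ s, inverseCoord g e z (a s) (b s)) y := fun b =>
    (contDiffAt_prod (t := Finset.univ) fun s _ =>
      contDiffAt_inverseCoord hd hdet (a s) (b s)).differentiableAt one_ne_zero
  have hW : ∀ k b, DifferentiableAt ℝ (W k b) y := differentiableAt_weighted hd hdet hu hΦ
  have hsq : DifferentiableAt ℝ (fun z => Real.sqrt (metricCoord g e z).det) y :=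
    ((contDiffAt_det hd).differentiableAt one_ne_zero).sqrt hdet.ne'
  have hsum : ∀ k, DifferentiableAt ℝ (fun z => ∑ b : Fin m → Fin n,
      (∏ s, inverseCoord g e z (a s) (b s)) * W k b z) y := fun k =>
    DifferentiableAt.fun_sum fun b _ => (hP b).mul (hW k b)
  -- the product rule, with the derivatives of `√g` and `g^{ab}` expressed by Christoffel symbols
  have h1 : ∀ k, pd k (fun z => Real.sqrt (metricCoord g e z).det
      * (u z * raised g e Φ (Fin.cons k a) z)) y
      = Real.sqrt (metricCoord g e y).det * ((∑ p, christoffel g e p p k y) * V k a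
        + ∑ b : Fin m → Fin n, (∏ s, inverseCoord g e y (a s) (b s)) * pd k (W k b) y
        - ∑ s, ∑ p, christoffel g e (a s) k p y * V k (Function.update a s p)
        - ∑ b, (∑ s, ∑ p, christoffel g e (b s) k p y
            * ∏ t, inverseCoord g e y (a t) (Function.update b s p t)) * W k b y) := by
    intro k
    simp only [mul_raised_cons]
    rw [pd_mul k hsq (hsum k), pd_sqrt_det hs hd hdet,
      pd_sum k (φ := fun b z => (∏ s, inverseCoord g e z (a s) (b s)) * W k b z)
        fun b _ => (hP b).mul (hW k b)]
    simp only [pd_mul k (hP _) (hW k _), pd_prod_inverseCoord hs hd hdet, hV]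
    have hA : ∑ s, ∑ p, christoffel g e (a s) k p y * ∑ b : Fin m → Fin n,
          (∏ t, inverseCoord g e y (Function.update a s p t) (b t)) * W k b y
        = ∑ b : Fin m → Fin n, (∑ s, ∑ p, christoffel g e (a s) k p y
            * ∏ t, inverseCoord g e y (Function.update a s p t) (b t)) * W k b y := by
      simp only [Finset.mul_sum, Finset.sum_mul]
      refine (Finset.sum_congr rfl fun s _ => Finset.sum_comm).trans (Finset.sum_comm.trans ?_)
      exact Finset.sum_congr rfl fun b _ => Finset.sum_congr rfl fun s _ =>
        Finset.sum_congr rfl fun p _ => by ring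
    rw [hA]
    simp only [sub_mul, neg_mul, Finset.sum_add_distrib, Finset.sum_sub_distrib,
      Finset.sum_neg_distrib]
    ring
  -- symmetric times antisymmetric
  have h2 : ∀ s, ∑ k, ∑ p, christoffel g e (a s) k p y * V k (Function.update a s p) = 0 := by
    intro s
    have h : ∑ k, ∑ p, christoffel g e (a s) k p y * V k (Function.update a s p)
        = -∑ k, ∑ p, christoffel g e (a s) k p y * V k (Function.update a s p) := by
      conv_rhs => rw [Finset.sum_comm]
      simp only [← Finset.sum_neg_distrib]
      refine Finset.sum_congr rfl fun k _ => Finset.sum_congr rfl fun p _ => ?_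
      simp only [V]
      rw [raised_cons_update, christoffel_symm hs]
      ring
    linarith
  -- the Christoffel terms of the covariant derivative, after exchanging `p` and `bₛ`
  have h3 : ∀ k, ∑ b : Fin m → Fin n, (∑ s, ∑ p, christoffel g e (b s) k p y
        * ∏ t, inverseCoord g e y (a t) (Function.update b s p t)) * W k b y
      = ∑ b : Fin m → Fin n, (∏ t, inverseCoord g e y (a t) (b t))
          * ∑ p, ∑ s, christoffel g e p k (b s) y * W k (Function.update b s p) y := by
    intro k
    have h : ∀ s, ∑ b : Fin m → Fin n, ∑ p, christoffel g e (b s) k p y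
          * (∏ t, inverseCoord g e y (a t) (Function.update b s p t)) * W k b y
        = ∑ b : Fin m → Fin n, ∑ p, (∏ t, inverseCoord g e y (a t) (b t))
          * (christoffel g e p k (b s) y * W k (Function.update b s p) y) := by
      intro s
      rw [← sum_update_comm s fun b p => (∏ t, inverseCoord g e y (a t) (b t))
          * (christoffel g e p k (b s) y * W k (Function.update b s p) y)]
      refine Finset.sum_congr rfl fun b _ => Finset.sum_congr rfl fun p _ => ?_
      simp only [Function.update_self, Function.update_idem, Function.update_eq_self]
      ring
    simp only [Finset.sum_mul, Finset.mul_sum]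
    rw [Finset.sum_comm]
    simp only [h]
    rw [Finset.sum_comm]
    exact Finset.sum_congr rfl fun b _ => Finset.sum_comm
  have h4 : ∑ k, (∑ p, christoffel g e p p k y) * V k a
      = ∑ b : Fin m → Fin n, (∏ s, inverseCoord g e y (a s) (b s))
          * ∑ k, ∑ p, christoffel g e k k p y * W p b y := by
    simp only [hV, Finset.sum_mul, Finset.mul_sum]
    refine Finset.sum_comm.trans ?_
    refine Finset.sum_congr rfl fun b _ => Finset.sum_comm.trans ?_
    exact Finset.sum_congr rfl fun k _ => Finset.sum_congr rfl fun p _ => by ring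
  simp only [h1, ← Finset.mul_sum, h3]
  congr 1
  simp only [Finset.sum_add_distrib, Finset.sum_sub_distrib, h4]
  have h2' : ∑ k, ∑ s, ∑ p, christoffel g e (a s) k p y * V k (Function.update a s p) = 0 := by
    rw [Finset.sum_comm]
    simp only [h2, Finset.sum_const_zero]
  simp only [h2', sub_zero, covDiv, Finset.sum_add_distrib,
    Finset.sum_sub_distrib, mul_add, mul_sub]
  have h5 : ∀ f : Fin n → (Fin m → Fin n) → ℝ,
      ∑ k, ∑ b : Fin m → Fin n, (∏ s, inverseCoord g e y (a s) (b s)) * f k b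
        = ∑ b : Fin m → Fin n, (∏ s, inverseCoord g e y (a s) (b s)) * ∑ k, f k b := by
    intro f
    rw [Finset.sum_comm]
    simp only [Finset.mul_sum]
  rw [h5, h5]
  ring

end Divergence

section Bridges

variable {n : ℕ} {M : Type*} [TopologicalSpace M] [ChartedSpace (Model n) M]
  {g : BilinField n M} {e : OpenPartialHomeomorph M (Model n)} {y : Model n}

/-- `F_i{}^k = -F^k{}_i`. -/
theorem weightedF_eq (f : M → ℝ) (F : FormField n M 2) (i k : Fin n) (y : Model n) :
    weightedF g f F e i k y
      = -weighted g e (fun z => Real.exp (-f (e.symm z))) (formRep e F) k ![i] y := by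
  rw [weightedF, weighted, ← neg_mul, ← Finset.sum_neg_distrib]
  congr 1
  refine Finset.sum_congr rfl fun l _ => ?_
  rw [← mul_neg]
  congr 1
  have h := (formRep e F y).toAlternatingMap.map_swap
    (fun s => EuclideanSpace.single ((![l, i] : Fin 2 → Fin n) s) (1 : ℝ))
    (show (0 : Fin 2) ≠ 1 by decide)
  refine Eq.trans ?_ h
  change formRep e F y _ = formRep e F y _
  congr 1
  funext s
  fin_cases s <;> rfl

theorem divF_eq (f : M → ℝ) (F : FormField n M 2) (i : Fin n) (y : Model n) :
    divF g f F e i y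
      = -covDiv g e (weighted g e (fun z => Real.exp (-f (e.symm z))) (formRep e F)) ![i] y := by
  rw [divF, covDiv, ← Finset.sum_neg_distrib]
  refine Finset.sum_congr rfl fun k _ => ?_
  have h : weightedF g f F e i k
      = fun z => -weighted g e (fun z => Real.exp (-f (e.symm z))) (formRep e F) k ![i] z :=
    funext fun z => weightedF_eq f F i k z
  rw [h, pd_neg, neg_add, ← Finset.sum_neg_distrib]
  congr 1
  refine Finset.sum_congr rfl fun p _ => ?_
  have hu : Function.update (![i] : Fin 1 → Fin n) 0 p = ![p] := by
    funext s; fin_cases s; rfl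
  simp only [weightedF_eq, Fin.sum_univ_one, hu, Matrix.cons_val_fin_one]
  ring

theorem divH_eq (f : M → ℝ) (H : FormField n M 3) (i j : Fin n) (y : Model n) :
    divH g f H e i j y
      = covDiv g e (weighted g e (fun z => Real.exp (-f (e.symm z))) (formRep e H)) ![i, j] y := by
  have hw : ∀ k b c z, weightedH g f H e k b c z
      = weighted g e (fun z => Real.exp (-f (e.symm z))) (formRep e H) k ![b, c] z :=
    fun _ _ _ _ => rfl
  rw [divH, covDiv]
  refine Finset.sum_congr rfl fun k _ => ?_
  congr 1
  refine Finset.sum_congr rfl fun p _ => ?_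
  have hu : Function.update (![i, j] : Fin 2 → Fin n) 0 p = ![p, j] := by
    funext s; fin_cases s <;> rfl
  have hv : Function.update (![i, j] : Fin 2 → Fin n) 1 p = ![i, p] := by
    funext s; fin_cases s <;> rfl
  simp only [hw, Fin.sum_univ_two, hu, hv, Matrix.cons_val_zero, Matrix.cons_val_one]
  ring

variable {m : ℕ}

/-- By antisymmetry every summand of `dβ` contributes equally to `⟨Φ, dβ⟩`. -/
theorem contract_extDeriv (hs : ∀ z, (metricCoord g e z).IsSymm)
    (Φ : Model n → Model n [⋀^Fin (m + 1)]→L[ℝ] ℝ) {β : Model n → Model n [⋀^Fin m]→L[ℝ] ℝ}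
    (hβ : DifferentiableAt ℝ β y) :
    contract (inverseCoord g e y) (comps (Φ y)) (comps (extDeriv β y))
      = (m + 1) * ∑ k, ∑ a : Fin m → Fin n,
          raised g e Φ (Fin.cons k a) y * pd k (fun z => comps (β z) a) y := by
  have hr : ∀ b, pullArray (inverseCoord g e y) (comps (Φ y)) b = raised g e Φ b y := by
    intro b
    simp only [pullArray, raised, inverseCoord_symm hs y (b _)]
  have hx : ∀ b : Fin (m + 1) → Fin n, comps (extDeriv β y) b
      = ∑ i : Fin (m + 1), (-1) ^ (i : ℕ) * pd (b i) (fun z => comps (β z) (i.removeNth b)) y := by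
    intro b
    rw [comps, extDeriv_apply hβ]
    refine Finset.sum_congr rfl fun i _ => ?_
    simp only [zsmul_eq_mul, Int.cast_pow, Int.cast_neg, Int.cast_one]
    rfl
  rw [contract_eq_sum_pullArray]
  simp only [hr, hx, Finset.mul_sum]
  rw [Finset.sum_comm]
  have h : ∀ i : Fin (m + 1), ∑ b : Fin (m + 1) → Fin n, raised g e Φ b y *
      ((-1) ^ (i : ℕ) * pd (b i) (fun z => comps (β z) (i.removeNth b)) y)
      = ∑ k, ∑ a : Fin m → Fin n,
          raised g e Φ (Fin.cons k a) y * pd k (fun z => comps (β z) a) y := by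
    intro i
    rw [← (Fin.insertNthEquiv (fun _ => Fin n) i).sum_comp, Fintype.sum_prod_type]
    refine Finset.sum_congr rfl fun k _ => Finset.sum_congr rfl fun a _ => ?_
    rw [← raised_insertNth Φ i]
    have hc : Fin.insertNthEquiv (fun _ => Fin n) i (k, a) = i.insertNth k a := rfl
    rw [hc, Fin.insertNth_apply_same, Fin.removeNth_insertNth]
    ring
  simp only [h, Finset.sum_const, Finset.card_univ, Fintype.card_fin, nsmul_eq_mul]
  push_cast
  simp only [Finset.mul_sum]

end Bridges

/-! ### The divergence theorem for compactly supported fields -/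

section IntegrationByParts

variable {n : ℕ}

/-- A compactly supported field on an open set has divergence of integral zero. -/
theorem setIntegral_sum_pd_eq_zero {U K : Set (Model n)} (hU : IsOpen U) (hK : IsCompact K)
    (hKU : K ⊆ U) {X : Fin n → Model n → ℝ} (hX : ∀ i, ContDiffOn ℝ 1 (X i) U)
    (hX0 : ∀ i, ∀ z ∈ U, z ∉ K → X i z = 0) :
    ∫ z in U, ∑ i, pd i (X i) z = 0 := by
  let Y : Fin n → Model n → ℝ := fun i => U.indicator (X i)
  have hYU : ∀ i, ∀ z ∈ U, Y i =ᶠ[nhds z] X i := fun i z hz =>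
    Filter.eventuallyEq_of_mem (hU.mem_nhds hz) fun w hw => Set.indicator_of_mem hw _
  have hY0 : ∀ i, ∀ z, z ∉ K → Y i z = 0 := fun i z hz => by
    by_cases h : z ∈ U
    · simp only [Y, Set.indicator_of_mem h, hX0 i z h hz]
    · exact Set.indicator_of_notMem h _
  have hYK : ∀ i, ∀ z, z ∉ K → Y i =ᶠ[nhds z] fun _ => 0 := fun i z hz =>
    Filter.eventuallyEq_of_mem (hK.isClosed.isOpen_compl.mem_nhds hz) fun w hw => hY0 i w hw
  have hYc : ∀ i, ContDiff ℝ 1 (Y i) := fun i => contDiff_iff_contDiffAt.2 fun z => by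
    by_cases hz : z ∈ U
    · exact ((hX i).contDiffAt (hU.mem_nhds hz)).congr_of_eventuallyEq (hYU i z hz)
    · exact contDiffAt_const.congr_of_eventuallyEq (hYK i z fun h => hz (hKU h))
  have hYs : ∀ i, HasCompactSupport (Y i) := fun i => HasCompactSupport.intro hK fun z => hY0 i z
  have hpc : ∀ i, Continuous (pd i (Y i)) := fun i =>
    ((hYc i).continuous_fderiv one_ne_zero).clm_apply continuous_const
  have hps : ∀ i, HasCompactSupport (pd i (Y i)) := fun i => (hYs i).fderiv_apply ℝ _
  have h1 : ∀ i, ∫ z, pd i (Y i) z = 0 := by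
    intro i
    -- integration by parts against the constant function `1`
    have h := integral_mul_fderiv_eq_neg_fderiv_mul_of_integrable
      (μ := (volume : Measure (Model n))) (f := fun _ => (1 : ℝ)) (g := Y i)
      (v := EuclideanSpace.single i 1) (by simp)
      (by simp only [one_mul]; exact (hpc i).integrable_of_hasCompactSupport (hps i))
      (by simpa using (hYc i).continuous.integrable_of_hasCompactSupport (hYs i))
      (fun _ _ => differentiableAt_const _)
      (fun z _ => (hYc i).differentiable one_ne_zero z)
    simpa [pd] using h
  have h2 : ∫ z in U, ∑ i, pd i (X i) z = ∫ z in U, ∑ i, pd i (Y i) z :=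
    setIntegral_congr_fun hU.measurableSet fun z hz =>
      Finset.sum_congr rfl fun i _ => (pd_congr (hYU i z hz)).symm
  have h3 : ∫ z in U, ∑ i, pd i (Y i) z = ∫ z, ∑ i, pd i (Y i) z := by
    refine setIntegral_eq_integral_of_forall_compl_eq_zero fun z hz => ?_
    refine Finset.sum_eq_zero fun i _ => ?_
    rw [pd_congr (hYK i z fun h => hz (hKU h)), pd_const]
  rw [h2, h3, integral_finsetSum _ fun i _ => (hpc i).integrable_of_hasCompactSupport (hps i)]
  exact Finset.sum_eq_zero fun i _ => h1 i

variable {m : ℕ} {M : Type*} [TopologicalSpace M] [ChartedSpace (Model n) M]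
  {g : BilinField n M} {e : OpenPartialHomeomorph M (Model n)}

theorem contDiffOn_comps {r : WithTop ℕ∞} {U : Set (Model n)}
    {Φ : Model n → Model n [⋀^Fin m]→L[ℝ] ℝ} (h : ContDiffOn ℝ r Φ U) (a : Fin m → Fin n) :
    ContDiffOn ℝ r (fun z => comps (Φ z) a) U :=
  (ContinuousAlternatingMap.apply ℝ (Model n) ℝ
    (fun s => EuclideanSpace.single (a s) (1 : ℝ))).contDiff.comp_contDiffOn h

/-- A form `Φ` whose weighted divergence vanishes is orthogonal to the exact form `dβ`, for every
compactly supported `β`. -/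
theorem setIntegral_contract_extDeriv_eq_zero (hs : ∀ z, (metricCoord g e z).IsSymm)
    (hd : ∀ i j, ContDiffOn ℝ 1 (fun z => metricCoord g e z i j) e.target)
    (hdet : ∀ z ∈ e.target, 0 < (metricCoord g e z).det) {u : Model n → ℝ}
    (hu : ContDiffOn ℝ 1 u e.target) {Φ : Model n → Model n [⋀^Fin (m + 1)]→L[ℝ] ℝ}
    (hΦ : ContDiffOn ℝ 1 Φ e.target)
    (hdiv : ∀ z ∈ e.target, ∀ b, covDiv g e (weighted g e u Φ) b z = 0)
    {β : Model n → Model n [⋀^Fin m]→L[ℝ] ℝ} (hβ : ContDiffOn ℝ 1 β e.target)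
    {K : Set (Model n)} (hK : IsCompact K) (hKU : K ⊆ e.target)
    (hβ0 : ∀ z ∈ e.target, z ∉ K → β z = 0) :
    ∫ z in e.target, Real.sqrt (metricCoord g e z).det
      * (u z * contract (inverseCoord g e z) (comps (Φ z)) (comps (extDeriv β z))) = 0 := by
  have hU := e.open_target
  have hdA : ∀ z ∈ e.target, ∀ i j, ContDiffAt ℝ 1 (fun z => metricCoord g e z i j) z :=
    fun z hz i j => (hd i j).contDiffAt (hU.mem_nhds hz)
  have hsq : ContDiffOn ℝ 1 (fun z => Real.sqrt (metricCoord g e z).det) e.target :=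
    fun z hz => ((contDiffAt_det (hdA z hz)).sqrt (hdet z hz).ne').contDiffWithinAt
  have hr : ∀ c, ContDiffOn ℝ 1 (raised g e Φ c) e.target := fun c =>
    ContDiffOn.sum fun b _ => (contDiffOn_prod fun s _ => fun z hz =>
      (contDiffAt_inverseCoord (hdA z hz) (hdet z hz) _ _).contDiffWithinAt).mul
        (contDiffOn_comps hΦ b)
  have hV : ∀ k a, ContDiffOn ℝ 1 (fun z => Real.sqrt (metricCoord g e z).det
      * (u z * raised g e Φ (Fin.cons k a) z)) e.target := fun k a => hsq.mul (hu.mul (hr _))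
  let X : Fin n → Model n → ℝ := fun k z => ∑ a : Fin m → Fin n,
    (Real.sqrt (metricCoord g e z).det * (u z * raised g e Φ (Fin.cons k a) z)) * comps (β z) a
  have hX := setIntegral_sum_pd_eq_zero hU hK hKU (X := X)
    (fun k => ContDiffOn.sum fun a _ => (hV k a).mul (contDiffOn_comps hβ a))
    (fun k z hz hzK => Finset.sum_eq_zero fun a _ => by
      rw [hβ0 z hz hzK]; exact mul_zero _)
  have hint : ∀ z ∈ e.target, Real.sqrt (metricCoord g e z).det
      * (u z * contract (inverseCoord g e z) (comps (Φ z)) (comps (extDeriv β z)))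
      = (m + 1) * ∑ k, pd k (X k) z := by
    intro z hz
    have hz' := hU.mem_nhds hz
    have hdiff : ∀ {φ : Model n → ℝ}, ContDiffOn ℝ 1 φ e.target → DifferentiableAt ℝ φ z :=
      fun h => (h.contDiffAt hz').differentiableAt one_ne_zero
    have hβz := fun a => hdiff (contDiffOn_comps hβ a)
    have h1 : ∀ k, pd k (X k) z = ∑ a : Fin m → Fin n,
        (pd k (fun z => Real.sqrt (metricCoord g e z).det
          * (u z * raised g e Φ (Fin.cons k a) z)) z * comps (β z) a
        + (Real.sqrt (metricCoord g e z).det * (u z * raised g e Φ (Fin.cons k a) z))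
          * pd k (fun z => comps (β z) a) z) := by
      intro k
      rw [pd_sum k (φ := fun a z => (Real.sqrt (metricCoord g e z).det
        * (u z * raised g e Φ (Fin.cons k a) z)) * comps (β z) a)
        fun a _ => (hdiff (hV k a)).mul (hβz a)]
      exact Finset.sum_congr rfl fun a _ => pd_mul k (hdiff (hV k a)) (hβz a)
    have h2 : ∑ k, ∑ a : Fin m → Fin n, pd k (fun z => Real.sqrt (metricCoord g e z).det
          * (u z * raised g e Φ (Fin.cons k a) z)) z * comps (β z) a = 0 := by
      rw [Finset.sum_comm]
      refine Finset.sum_eq_zero fun a _ => ?_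
      rw [← Finset.sum_mul, sum_pd_sqrt_det_mul_raised hs (hdA z hz) (hdet z hz) (hdiff hu)
        fun c => hdiff (contDiffOn_comps hΦ c)]
      simp only [hdiv z hz, mul_zero, Finset.sum_const_zero, zero_mul]
    rw [contract_extDeriv hs Φ ((hβ.contDiffAt hz').differentiableAt one_ne_zero)]
    simp only [h1, Finset.sum_add_distrib, h2, zero_add, Finset.mul_sum]
    exact Finset.sum_congr rfl fun k _ => Finset.sum_congr rfl fun a _ => by ring
  rw [setIntegral_congr_fun hU.measurableSet hint, integral_const_mul, hX, mul_zero]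

end IntegrationByParts

/-! ### Change of chart -/

section ChangeOfChart

variable {n : ℕ} {M : Type*} [TopologicalSpace M] [ChartedSpace (Model n) M]

/-- The derivative of `e⁻¹`, as an endomorphism of `ℝⁿ`. -/
noncomputable def symmDeriv (e : OpenPartialHomeomorph M (Model n)) (y : Model n) :
    Model n →L[ℝ] Model n :=
  mfderiv (𝓡 n) (𝓡 n) e.symm y

/-- The derivative of `e`, as an endomorphism of `ℝⁿ`. -/
noncomputable def chartDeriv (e : OpenPartialHomeomorph M (Model n)) (x : M) :
    Model n →L[ℝ] Model n :=
  mfderiv (𝓡 n) (𝓡 n) e x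

/-- The metric `g` pulled back to `ℝⁿ` by `e⁻¹`. -/
noncomputable def metricRep (g : BilinField n M) (e : OpenPartialHomeomorph M (Model n))
    (y : Model n) : Model n →L[ℝ] Model n →L[ℝ] ℝ :=
  ContinuousLinearMap.bilinearComp
    (show Model n →L[ℝ] Model n →L[ℝ] ℝ from g (e.symm y)) (symmDeriv e y) (symmDeriv e y)

theorem metricCoord_apply (g : BilinField n M) (e : OpenPartialHomeomorph M (Model n))
    (y : Model n) (i j : Fin n) :
    metricCoord g e y i j
      = metricRep g e y (EuclideanSpace.single i 1) (EuclideanSpace.single j 1) :=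
  rfl

theorem bilin_apply_eq_sum (b : Model n →L[ℝ] Model n →L[ℝ] ℝ) (v w : Model n) :
    b v w = ∑ i, ∑ j, v i * b (EuclideanSpace.single i 1) (EuclideanSpace.single j 1) * w j := by
  conv_lhs => rw [← sum_smul_single v, ← sum_smul_single w]
  simp only [map_sum, map_smul, sum_apply, smul_apply, smul_eq_mul, Finset.mul_sum]
  exact Finset.sum_comm.trans
    (Finset.sum_congr rfl fun i _ => Finset.sum_congr rfl fun j _ => by ring)

theorem eventually_symm_mem_source {X : Type*} [TopologicalSpace X]
    {e e' : OpenPartialHomeomorph X (Model n)} {y : Model n} (hy : y ∈ e.target)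
    (hy' : e.symm y ∈ e'.source) :
    ∀ᶠ z in nhds y, z ∈ e.target ∧ e.symm z ∈ e'.source :=
  Filter.Eventually.and (e.open_target.mem_nhds hy)
    ((e.continuousAt_symm hy).eventually (e'.open_source.mem_nhds hy'))

variable [IsManifold (𝓡 n) ∞ M] {e e' : OpenPartialHomeomorph M (Model n)} {y : Model n}

theorem contDiffAt_transition (he : e ∈ atlas (Model n) M) (he' : e' ∈ atlas (Model n) M)
    (hy : y ∈ e.target) (hy' : e.symm y ∈ e'.source) : ContDiffAt ℝ ∞ (e' ∘ e.symm) y := by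
  rw [← contMDiffAt_iff_contDiffAt]
  exact ContMDiffAt.comp y
    (contMDiffAt_of_mem_maximalAtlas (IsManifold.subset_maximalAtlas he') hy')
    (contMDiffAt_symm_of_mem_maximalAtlas (IsManifold.subset_maximalAtlas he) hy)

theorem mdifferentiableAt_chart (he : e ∈ atlas (Model n) M) {x : M} (hx : x ∈ e.source) :
    MDifferentiableAt (𝓡 n) (𝓡 n) e x :=
  (contMDiffAt_of_mem_maximalAtlas (n := ∞) (IsManifold.subset_maximalAtlas he)
    hx).mdifferentiableAt (by simp)

theorem mdifferentiableAt_chart_symm (he : e ∈ atlas (Model n) M) (hy : y ∈ e.target) :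
    MDifferentiableAt (𝓡 n) (𝓡 n) e.symm y :=
  (contMDiffAt_symm_of_mem_maximalAtlas (n := ∞) (IsManifold.subset_maximalAtlas he)
    hy).mdifferentiableAt (by simp)

theorem symmDeriv_eq_comp (he : e ∈ atlas (Model n) M) (he' : e' ∈ atlas (Model n) M)
    (hy : y ∈ e.target) (hy' : e.symm y ∈ e'.source) :
    symmDeriv e y = (symmDeriv e' (e' (e.symm y))).comp (fderiv ℝ (e' ∘ e.symm) y) := by
  have h1 : HasMFDerivAt (𝓡 n) (𝓡 n) (e' ∘ e.symm) y (fderiv ℝ (e' ∘ e.symm) y) :=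
    (((contDiffAt_transition he he' hy hy').differentiableAt
      (by simp)).hasFDerivAt).hasMFDerivAt
  have h2 : HasMFDerivAt (𝓡 n) (𝓡 n) e'.symm ((e' ∘ e.symm) y) _ :=
    (mdifferentiableAt_chart_symm he' (e'.map_source hy')).hasMFDerivAt
  have h3 := (h2.comp y h1).congr_of_eventuallyEq (f₁ := e.symm) (by
    filter_upwards [eventually_symm_mem_source hy hy'] with z hz
    exact (e'.left_inv hz.2).symm)
  exact h3.mfderiv

theorem chartDeriv_comp_symmDeriv (he : e ∈ atlas (Model n) M) (he' : e' ∈ atlas (Model n) M)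
    (hy : y ∈ e.target) (hy' : e.symm y ∈ e'.source) :
    (chartDeriv e' (e.symm y)).comp (symmDeriv e y)
      = fderiv ℝ (e' ∘ e.symm) y := by
  rw [← mfderiv_eq_fderiv]
  exact (mfderiv_comp y (mdifferentiableAt_chart he' hy')
    (mdifferentiableAt_chart_symm he hy)).symm

theorem symmDeriv_injective (he : e ∈ atlas (Model n) M) (hy : y ∈ e.target) :
    Function.Injective (symmDeriv e y) := by
  have h := chartDeriv_comp_symmDeriv he he hy (e.map_target hy)
  have h1 : fderiv ℝ (e ∘ e.symm) y = ContinuousLinearMap.id ℝ (Model n) := by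
    rw [Filter.EventuallyEq.fderiv_eq (f := id), fderiv_id]
    filter_upwards [e.open_target.mem_nhds hy] with z hz using e.right_inv hz
  rw [h1] at h
  intro v w hvw
  have h2 := congrArg (fun L => L v) h
  have h3 := congrArg (fun L => L w) h
  simp only [ContinuousLinearMap.comp_apply, ContinuousLinearMap.id_apply] at h2 h3
  rw [← h2, ← h3, hvw]

theorem formRep_change {k : ℕ} (α : FormField n M k) (he : e ∈ atlas (Model n) M)
    (he' : e' ∈ atlas (Model n) M) (hy : y ∈ e.target) (hy' : e.symm y ∈ e'.source) :
    formRep e α y = (formRep e' α (e' (e.symm y))).compContinuousLinearMap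
      (fderiv ℝ (e' ∘ e.symm) y) := by
  let α' : M → Model n [⋀^Fin k]→L[ℝ] ℝ := α
  ext v
  change α' (e.symm y) (fun s => symmDeriv e y (v s))
    = α' (e'.symm (e' (e.symm y)))
        fun s => symmDeriv e' (e' (e.symm y)) (fderiv ℝ (e' ∘ e.symm) y (v s))
  rw [e'.left_inv hy', symmDeriv_eq_comp he he' hy hy']
  rfl

theorem metricRep_change (g : BilinField n M) (he : e ∈ atlas (Model n) M)
    (he' : e' ∈ atlas (Model n) M) (hy : y ∈ e.target) (hy' : e.symm y ∈ e'.source)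
    (v w : Model n) :
    metricRep g e y v w = metricRep g e' (e' (e.symm y))
      (fderiv ℝ (e' ∘ e.symm) y v) (fderiv ℝ (e' ∘ e.symm) y w) := by
  let g' : M → Model n →L[ℝ] Model n →L[ℝ] ℝ := g
  change g' (e.symm y) (symmDeriv e y v) (symmDeriv e y w)
    = g' (e'.symm (e' (e.symm y)))
        (symmDeriv e' (e' (e.symm y)) (fderiv ℝ (e' ∘ e.symm) y v))
        (symmDeriv e' (e' (e.symm y)) (fderiv ℝ (e' ∘ e.symm) y w))
  rw [e'.left_inv hy', symmDeriv_eq_comp he he' hy hy']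
  rfl

theorem metricCoord_change (g : BilinField n M) (he : e ∈ atlas (Model n) M)
    (he' : e' ∈ atlas (Model n) M) (hy : y ∈ e.target) (hy' : e.symm y ∈ e'.source) :
    metricCoord g e y = (stdMatrix (fderiv ℝ (e' ∘ e.symm) y)).transpose
      * metricCoord g e' (e' (e.symm y)) * stdMatrix (fderiv ℝ (e' ∘ e.symm) y) := by
  ext i j
  rw [metricCoord_apply, metricRep_change g he he' hy hy', bilin_apply_eq_sum]
  simp only [Matrix.mul_apply, Finset.sum_mul]
  rw [Finset.sum_comm]
  rfl

/-- The exterior derivative may be computed in any chart. -/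
theorem formRep_extD {k : ℕ} {α : FormField n M k} (hα : IsSmoothForm α)
    (he : e ∈ atlas (Model n) M) (hy : y ∈ e.target) :
    formRep e (extD α) y = extDeriv (formRep e α) y := by
  let e' := chartAt (Model n) (e.symm y)
  have he' : e' ∈ atlas (Model n) M := chart_mem_atlas _ _
  have hy' : e.symm y ∈ e'.source := mem_chart_source _ _
  have h1 : formRep e α =ᶠ[nhds y] fun z => (formRep e' α ((e' ∘ e.symm) z)).compContinuousLinearMap
      (fderiv ℝ (e' ∘ e.symm) z) := by
    filter_upwards [eventually_symm_mem_source hy hy'] with z hz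
    exact formRep_change α he he' hz.1 hz.2
  have hd : DifferentiableAt ℝ (formRep e' α) ((e' ∘ e.symm) y) :=
    ((hα e' he').contDiffAt (e'.open_target.mem_nhds (e'.map_source hy'))).differentiableAt
      (by simp)
  rw [h1.extDeriv_eq, extDeriv_pullback hd (contDiffAt_transition he he' hy hy')
    (by
      rw [minSmoothness_of_isRCLikeNormedField]
      exact ENat.LEInfty.out),
    ← chartDeriv_comp_symmDeriv he he' hy hy']
  rfl

theorem contDiffOn_formRep_extD {k : ℕ} {α : FormField n M k} (hα : IsSmoothForm α)
    (he : e ∈ atlas (Model n) M) : ContDiffOn ℝ ∞ (formRep e (extD α)) e.target := by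
  have h : ContDiffOn ℝ ∞ (fun z => ContinuousAlternatingMap.alternatizeUncurryFinCLM ℝ (Model n) ℝ
      (fderiv ℝ (formRep e α) z)) e.target :=
    (ContinuousLinearMap.contDiff _).comp_contDiffOn
      ((hα e he).fderiv_of_isOpen e.open_target (by simp))
  exact h.congr fun z hz => formRep_extD hα he hz

end ChangeOfChart

section Metric

variable {n : ℕ} {M : Type*} [TopologicalSpace M] [ChartedSpace (Model n) M]
  [IsManifold (𝓡 n) ∞ M] (g : RMetric n M) {e e' : OpenPartialHomeomorph M (Model n)}
  {y : Model n}

theorem metricCoord_isSymm (e : OpenPartialHomeomorph M (Model n)) (y : Model n) :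
    (metricCoord g.inner e y).IsSymm :=
  Matrix.IsSymm.ext fun _ _ => g.symm _ _ _

theorem metricCoord_posDef (he : e ∈ atlas (Model n) M) (hy : y ∈ e.target) :
    (metricCoord g.inner e y).PosDef := by
  refine Matrix.PosDef.of_dotProduct_mulVec_pos ?_ fun x hx => ?_
  · rw [Matrix.IsHermitian, Matrix.conjTranspose_eq_transpose_of_trivial]
    exact metricCoord_isSymm g e y
  · let v : Model n := WithLp.toLp 2 x
    have hv : v ≠ 0 := fun h => hx (by
      funext i
      exact congrArg (fun w : Model n => w i) h)
    have h := g.pos (e.symm y) (symmDeriv e y v) (fun h => hv (symmDeriv_injective he hy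
      (h.trans (map_zero (symmDeriv e y)).symm)))
    have h' : 0 < metricRep g.inner e y v v := h
    rw [bilin_apply_eq_sum] at h'
    refine lt_of_lt_of_eq h' ?_
    simp only [dotProduct, Matrix.mulVec, Finset.mul_sum, star_trivial, metricCoord_apply]
    exact Finset.sum_congr rfl fun i _ => Finset.sum_congr rfl fun j _ => by
      simp only [v]; ring

theorem inverseCoord_posDef (he : e ∈ atlas (Model n) M) (hy : y ∈ e.target) :
    (inverseCoord g.inner e y).PosDef :=
  (metricCoord_posDef g he hy).inv

theorem contDiffOn_metricCoord (he : e ∈ atlas (Model n) M) (i j : Fin n) :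
    ContDiffOn ℝ ∞ (fun z => metricCoord g.inner e z i j) e.target := by
  have hs : ContMDiffOn (𝓡 n) (𝓡 n) ∞ e.symm e.target :=
    contMDiffOn_symm_of_mem_maximalAtlas (IsManifold.subset_maximalAtlas he)
  have ht := hs.contMDiffOn_tangentMapWithin (m := ∞) (by simp) e.open_target.uniqueMDiffOn
  have hv : ∀ i : Fin n, ContMDiffOn (𝓡 n) ((𝓡 n).prod (𝓡 n)) ∞
      (fun z => TotalSpace.mk' (Model n) (E := fun x : M => TangentSpace (𝓡 n) x) (e.symm z)
        (frame e z i)) e.target := by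
    intro i
    have hc : ContMDiff (𝓡 n) ((𝓡 n).prod (𝓡 n)) ∞
        (fun z : Model n => (TotalSpace.mk' (Model n)
          (E := fun x : Model n => TangentSpace (𝓡 n) x) z
            (EuclideanSpace.single i (1 : ℝ) : Model n))) := by
      intro z
      rw [contMDiffAt_totalSpace]
      refine ⟨contMDiffAt_id, ?_⟩
      simpa using contMDiffAt_const
    refine (ht.comp hc.contMDiffOn fun z hz => hz).congr fun z hz => ?_
    simp only [Function.comp_apply, tangentMapWithin, frame]
    rw [mfderivWithin_of_mem_nhds (e.open_target.mem_nhds hz)]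
  have h : ContMDiffOn (𝓡 n) ((𝓡 n).prod 𝓘(ℝ, ℝ)) ∞
      (fun z => TotalSpace.mk' ℝ (E := Bundle.Trivial M ℝ) (e.symm z)
        (g.inner (e.symm z) (frame e z i) (frame e z j))) e.target :=
    ContMDiffOn.clm_bundle_apply₂ (F₁ := Model n) (F₂ := Model n)
      (g.contMDiff.comp_contMDiffOn hs) (hv i) (hv j)
  intro z hz
  have hz' := h z hz
  simp only [contMDiffWithinAt_totalSpace] at hz'
  exact hz'.2.contDiffWithinAt

/-- The full contraction of two forms does not depend on the chart. -/
theorem contract_change {k : ℕ} (α β : FormField n M k) (he : e ∈ atlas (Model n) M)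
    (he' : e' ∈ atlas (Model n) M) (hy : y ∈ e.target) (hy' : e.symm y ∈ e'.source) :
    contract (inverseCoord g.inner e y) (comps (formRep e α y)) (comps (formRep e β y))
      = contract (inverseCoord g.inner e' (e' (e.symm y)))
          (comps (formRep e' α (e' (e.symm y)))) (comps (formRep e' β (e' (e.symm y)))) := by
  rw [formRep_change α he he' hy hy', formRep_change β he he' hy hy',
    comps_compContinuousLinearMap, comps_compContinuousLinearMap, contract_pullArray]
  congr 1
  have hdet := (metricCoord_posDef g he hy).det_pos
  rw [inverseCoord, metricCoord_change g.inner he he' hy hy'] at *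
  set J := stdMatrix (fderiv ℝ (e' ∘ e.symm) y)
  rw [Matrix.det_mul] at hdet
  have hJ : IsUnit J.det := isUnit_iff_ne_zero.2 (right_ne_zero_of_mul hdet.ne')
  rw [Matrix.mul_inv_rev, Matrix.mul_inv_rev, ← Matrix.mul_assoc, ← Matrix.mul_assoc,
    Matrix.mul_nonsing_inv _ hJ, Matrix.one_mul, Matrix.mul_assoc,
    Matrix.nonsing_inv_mul _ (by rwa [Matrix.det_transpose]), Matrix.mul_one]
  rfl

end Metric

/-! ### The Riemannian measure in a single chart -/

section Density

variable {n : ℕ} {M : Type*} [TopologicalSpace M] [ChartedSpace (Model n) M]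
  {e e' : OpenPartialHomeomorph M (Model n)}

/-- The Riemannian density `√(det g_{ij})` of the chart `e`. -/
noncomputable def density (g : BilinField n M) (e : OpenPartialHomeomorph M (Model n))
    (y : Model n) : ℝ :=
  Real.sqrt (metricCoord g e y).det

variable [IsManifold (𝓡 n) ∞ M] (g : RMetric n M)

theorem continuousOn_density (he : e ∈ atlas (Model n) M) :
    ContinuousOn (density g.inner e) e.target := fun _ hy =>
  Real.continuous_sqrt.continuousAt.comp_continuousWithinAt
    (contDiffAt_det (r := ∞) fun i j => (contDiffOn_metricCoord g he i j).contDiffAt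
      (e.open_target.mem_nhds hy)).continuousAt.continuousWithinAt

theorem density_pos (he : e ∈ atlas (Model n) M) {y : Model n} (hy : y ∈ e.target) :
    0 < density g.inner e y :=
  Real.sqrt_pos.2 (metricCoord_posDef g he hy).det_pos

theorem density_change (he : e ∈ atlas (Model n) M) (he' : e' ∈ atlas (Model n) M) {y : Model n}
    (hy : y ∈ e.target) (hy' : e.symm y ∈ e'.source) :
    density g.inner e y
      = |(fderiv ℝ (e' ∘ e.symm) y).det| * density g.inner e' (e' (e.symm y)) := by
  rw [density, metricCoord_change g.inner he he' hy hy', Matrix.det_mul, Matrix.det_mul,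
    Matrix.det_transpose, det_stdMatrix, mul_right_comm, ← sq, Real.sqrt_mul (sq_nonneg _),
    Real.sqrt_sq_eq_abs, density]

theorem aemeasurable_density (he : e ∈ atlas (Model n) M) :
    AEMeasurable (fun y => ENNReal.ofReal (density g.inner e y))
      ((volume : Measure (Model n)).restrict e.target) :=
  ENNReal.measurable_ofReal.comp_aemeasurable
    ((continuousOn_density g he).aemeasurable e.open_target.measurableSet)

end Density

section ChartMeasure

section Pushforward

variable {n : ℕ} {X : Type*} [TopologicalSpace X] [MeasurableSpace X] [BorelSpace X]

theorem aemeasurable_symm (e : OpenPartialHomeomorph X (Model n)) {w : Model n → ENNReal} :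
    AEMeasurable e.symm (((volume : Measure (Model n)).restrict e.target).withDensity w) :=
  (e.continuousOn_symm.aemeasurable e.open_target.measurableSet).mono_ac
    (withDensity_absolutelyContinuous _ _)

theorem map_withDensity_symm_apply (e : OpenPartialHomeomorph X (Model n)) (w : Model n → ENNReal)
    {s : Set X} (hs : MeasurableSet s) :
    ((((volume : Measure (Model n)).restrict e.target).withDensity w).map e.symm) s
      = ∫⁻ y in e.symm ⁻¹' s ∩ e.target, w y := by
  rw [Measure.map_apply_of_aemeasurable (aemeasurable_symm e) hs, withDensity_apply',
    Measure.restrict_restrict' e.open_target.measurableSet]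

theorem measurableSet_preimage_inter_target (e : OpenPartialHomeomorph X (Model n)) {s : Set X}
    (hs : MeasurableSet s) : MeasurableSet (e.symm ⁻¹' s ∩ e.target) := by
  have h := (continuousOn_iff_continuous_domRestrict.1 e.continuousOn_symm).measurable hs
  have h' := e.open_target.measurableSet.subtype_image h
  convert h' using 1
  ext y
  simp [and_comm]

end Pushforward

variable {n : ℕ} {M : Type*} [TopologicalSpace M] [ChartedSpace (Model n) M]
  [MeasurableSpace M] [BorelSpace M] {e e' : OpenPartialHomeomorph M (Model n)}

/-- The Riemannian measure on the domain of the chart `e`. -/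
noncomputable def chartMeasure (g : BilinField n M) (e : OpenPartialHomeomorph M (Model n)) :
    Measure M :=
  (((volume : Measure (Model n)).restrict e.target).withDensity fun y =>
    ENNReal.ofReal (density g e y)).map e.symm

variable [IsManifold (𝓡 n) ∞ M] (g : RMetric n M)

/-- The measures of two charts agree on the overlap of their domains, by the change of variables
formula. -/
theorem chartMeasure_eq (he : e ∈ atlas (Model n) M) (he' : e' ∈ atlas (Model n) M) {s : Set M}
    (hs : MeasurableSet s) (hse : s ⊆ e.source) (hse' : s ⊆ e'.source) :
    chartMeasure g.inner e s = chartMeasure g.inner e' s := by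
  rw [chartMeasure, chartMeasure, map_withDensity_symm_apply e _ hs,
    map_withDensity_symm_apply e' _ hs]
  have himage : (e' ∘ e.symm) '' (e.symm ⁻¹' s ∩ e.target) = e'.symm ⁻¹' s ∩ e'.target := by
    ext z
    constructor
    · rintro ⟨y, ⟨hy, hyt⟩, rfl⟩
      have hy' := hse' hy
      refine ⟨?_, e'.map_source hy'⟩
      simpa only [Set.mem_preimage, Function.comp_apply, e'.left_inv hy'] using hy
    · rintro ⟨hz, hzt⟩
      have hz' := hse hz
      refine ⟨e (e'.symm z), ⟨?_, e.map_source hz'⟩, ?_⟩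
      · simpa only [Set.mem_preimage, e.left_inv hz'] using hz
      · simp only [Function.comp_apply, e.left_inv hz', e'.right_inv hzt]
  have hinj : Set.InjOn (e' ∘ e.symm) (e.symm ⁻¹' s ∩ e.target) := by
    rintro y ⟨hy, hyt⟩ z ⟨hz, hzt⟩ h
    exact e.symm.injOn hyt hzt (e'.injOn (hse' hy) (hse' hz) h)
  rw [← himage, lintegral_image_eq_lintegral_abs_det_fderiv_mul volume
    (measurableSet_preimage_inter_target e hs) (fun y hy =>
      ((contDiffAt_transition he he' hy.2 (hse' hy.1)).differentiableAt
        (by simp)).hasFDerivAt.hasFDerivWithinAt) hinj]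
  refine setLIntegral_congr_fun (measurableSet_preimage_inter_target e hs) fun y hy => ?_
  simp only [Function.comp_apply]
  rw [← ENNReal.ofReal_mul (abs_nonneg _), density_change g he he' hy.2 (hse' hy.1)]

theorem integral_chartMeasure (he : e ∈ atlas (Model n) M) {h : M → ℝ} (hh : Continuous h) :
    ∫ x, h x ∂(chartMeasure g.inner e)
      = ∫ y in e.target, density g.inner e y * h (e.symm y) := by
  rw [chartMeasure, integral_map (aemeasurable_symm e) hh.aestronglyMeasurable,
    integral_withDensity_eq_integral_toReal_smul₀ (aemeasurable_density g he)
      (Filter.Eventually.of_forall fun _ => ENNReal.ofReal_lt_top)]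
  refine integral_congr_ae (Filter.Eventually.of_forall fun y => ?_)
  simp only [density, ENNReal.toReal_ofReal (Real.sqrt_nonneg _), smul_eq_mul]

theorem chartMeasure_pos (he : e ∈ atlas (Model n) M) {s : Set M} (hs : IsOpen s)
    (hse : s ⊆ e.source) (hne : s.Nonempty) : 0 < chartMeasure g.inner e s := by
  rw [chartMeasure, map_withDensity_symm_apply e _ hs.measurableSet, Set.inter_comm]
  obtain ⟨x, hx⟩ := hne
  have hopen : IsOpen (e.target ∩ e.symm ⁻¹' s) :=
    e.continuousOn_symm.isOpen_inter_preimage e.open_target hs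
  have hvol : 0 < (volume : Measure (Model n)) (e.target ∩ e.symm ⁻¹' s) :=
    hopen.measure_pos volume ⟨e x, e.map_source (hse hx), by
      simpa only [Set.mem_preimage, e.left_inv (hse hx)] using hx⟩
  rw [pos_iff_ne_zero, Ne, lintegral_eq_zero_iff' ((aemeasurable_density g he).mono_measure
    (Measure.restrict_mono Set.inter_subset_left le_rfl))]
  intro h
  have h1 := (ae_restrict_iff' hopen.measurableSet).1 h
  have h2 : (volume : Measure (Model n)) (e.target ∩ e.symm ⁻¹' s) = 0 := by
    refine measure_mono_null (fun y hy => ?_) h1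
    simp only [Set.mem_compl_iff, Set.mem_ofPred_eq, Classical.not_imp, Pi.zero_apply,
      ENNReal.ofReal_eq_zero, not_le]
    exact ⟨hy, density_pos g he hy.1⟩
  exact hvol.ne' h2

end ChartMeasure

/-! ### The Riemannian volume measure -/

section VolumeMeasure

variable {n : ℕ} {M : Type*} [TopologicalSpace M] [ChartedSpace (Model n) M]
  [IsManifold (𝓡 n) ∞ M] [CompactSpace M] [T2Space M]

variable (n M) in
/-- By compactness only finitely many functions of the partition of unity are nonzero. -/
theorem exists_finset_chartPartition : ∃ S : Finset M,
    (∀ c ∉ S, ∀ x, chartPartition n M c x = 0) ∧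
    ∀ x, ∑ c ∈ S, chartPartition n M c x = 1 := by
  have hf := (chartPartition n M).locallyFinite.finite_nonempty_of_compact
  have hS : ∀ c ∉ hf.toFinset, ∀ x, chartPartition n M c x = 0 := by
    intro c hc x
    by_contra hx
    exact hc (hf.mem_toFinset.2 ⟨x, hx⟩)
  refine ⟨hf.toFinset, hS, fun x => ?_⟩
  rw [← (chartPartition n M).sum_eq_one (Set.mem_univ x),
    finsum_eq_sum_of_support_subset _ fun c hc => ?_]
  by_contra h
  exact hc (hS c h x)

theorem chartPartition_eq_zero {c x : M} (hx : x ∉ (chartAt (Model n) c).source) :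
    chartPartition n M c x = 0 := by
  by_contra h
  exact hx (chartPartition_isSubordinate n M c (subset_tsupport _ h))

variable [MeasurableSpace M] [BorelSpace M] (g : RMetric n M)

/-- The summand of `volumeMeasure` that belongs to the chart at `c`. -/
noncomputable def volumePiece (g : BilinField n M) (c : M) : Measure M :=
  (((volume : Measure (Model n)).restrict (chartAt (Model n) c).target).withDensity fun y =>
    ENNReal.ofReal (chartPartition n M c ((chartAt (Model n) c).symm y)
      * density g (chartAt (Model n) c) y)).map (chartAt (Model n) c).symm

theorem volumeMeasure_eq_sum {S : Finset M}
    (hS : ∀ c ∉ S, ∀ x, chartPartition n M c x = 0) :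
    volumeMeasure g.inner = ∑ c ∈ S, volumePiece g.inner c := by
  have h : volumeMeasure g.inner = Measure.sum fun c => volumePiece g.inner c := rfl
  ext s hs
  rw [h, Measure.sum_apply _ hs, tsum_eq_sum (s := S), Measure.finsetSum_apply]
  intro c hc
  rw [volumePiece, map_withDensity_symm_apply _ _ hs]
  simp [hS c hc]

theorem volumePiece_apply (c : M) {s : Set M} (hs : MeasurableSet s) :
    volumePiece g.inner c s = ∫⁻ x in s, ENNReal.ofReal (chartPartition n M c x)
      ∂(chartMeasure g.inner (chartAt (Model n) c)) := by
  set e := chartAt (Model n) c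
  have he : e ∈ atlas (Model n) M := chart_mem_atlas _ _
  have hρ : Measurable fun x => ENNReal.ofReal (chartPartition n M c x) :=
    ENNReal.measurable_ofReal.comp (chartPartition n M c).contMDiff.continuous.measurable
  have hw : AEMeasurable (fun y => ENNReal.ofReal (density g.inner e y))
      ((volume : Measure (Model n)).restrict (e.symm ⁻¹' s ∩ e.target)) :=
    (aemeasurable_density g he).mono_measure (Measure.restrict_mono Set.inter_subset_right le_rfl)
  rw [volumePiece, map_withDensity_symm_apply _ _ hs, chartMeasure,
    Measure.restrict_map_of_aemeasurable (aemeasurable_symm e) hs,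
    lintegral_map' hρ.aemeasurable ((aemeasurable_symm e).mono_measure Measure.restrict_le_self),
    restrict_withDensity', Measure.restrict_restrict' e.open_target.measurableSet,
    lintegral_withDensity_eq_lintegral_mul₀ hw]
  · refine lintegral_congr fun y => ?_
    rw [Pi.mul_apply, mul_comm (chartPartition n M c _), density,
      ENNReal.ofReal_mul (Real.sqrt_nonneg _)]
  · exact hρ.comp_aemeasurable ((e.continuousOn_symm.aemeasurable
      e.open_target.measurableSet).mono_measure
        (Measure.restrict_mono Set.inter_subset_right le_rfl))

/-- On the domain of a preferred chart the volume measure is the measure of that chart. -/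
theorem volumeMeasure_apply_of_subset (d : M) {s : Set M} (hs : MeasurableSet s)
    (hsd : s ⊆ (chartAt (Model n) d).source) :
    volumeMeasure g.inner s = chartMeasure g.inner (chartAt (Model n) d) s := by
  obtain ⟨S, hS, hS1⟩ := exists_finset_chartPartition n M
  have hρ : ∀ c, Measurable fun x => ENNReal.ofReal (chartPartition n M c x) := fun c =>
    ENNReal.measurable_ofReal.comp (chartPartition n M c).contMDiff.continuous.measurable
  have h1 : ∀ c, volumePiece g.inner c s = ∫⁻ x in s, ENNReal.ofReal (chartPartition n M c x)
      ∂(chartMeasure g.inner (chartAt (Model n) d)) := by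
    intro c
    have hcs : MeasurableSet (s ∩ (chartAt (Model n) c).source) :=
      hs.inter (chartAt (Model n) c).open_source.measurableSet
    have hμ : (chartMeasure g.inner (chartAt (Model n) c)).restrict
          (s ∩ (chartAt (Model n) c).source)
        = (chartMeasure g.inner (chartAt (Model n) d)).restrict
          (s ∩ (chartAt (Model n) c).source) := by
      ext t ht
      rw [Measure.restrict_apply ht, Measure.restrict_apply ht]
      exact chartMeasure_eq g (chart_mem_atlas _ _) (chart_mem_atlas _ _) (ht.inter hcs)
        (fun x hx => hx.2.2) fun x hx => hsd hx.2.1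
    have hcut : ∀ μ : Measure M, ∫⁻ x in s, ENNReal.ofReal (chartPartition n M c x) ∂μ
        = ∫⁻ x in s ∩ (chartAt (Model n) c).source,
            ENNReal.ofReal (chartPartition n M c x) ∂μ := by
      intro μ
      rw [← lintegral_indicator hs, ← lintegral_indicator hcs]
      refine lintegral_congr fun x => ?_
      by_cases hx : x ∈ (chartAt (Model n) c).source
      · by_cases hxs : x ∈ s <;> simp [hx, hxs]
      · by_cases hxs : x ∈ s <;> simp [hx, hxs, chartPartition_eq_zero hx]
    rw [volumePiece_apply g c hs, hcut, hμ, ← hcut]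
  rw [volumeMeasure_eq_sum g hS, Measure.finsetSum_apply]
  simp only [h1]
  rw [← lintegral_finsetSum _ fun c _ => hρ c, ← setLIntegral_one]
  refine lintegral_congr fun x => ?_
  rw [← ENNReal.ofReal_sum_of_nonneg fun c _ => (chartPartition n M).nonneg c x, hS1,
    ENNReal.ofReal_one]

theorem integral_volumeMeasure_eq (d : M) {h : M → ℝ} (hh : Continuous h)
    (h0 : ∀ x ∉ (chartAt (Model n) d).source, h x = 0) :
    ∫ x, h x ∂(volumeMeasure g.inner) = ∫ y in (chartAt (Model n) d).target,
      density g.inner (chartAt (Model n) d) y * h ((chartAt (Model n) d).symm y) := by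
  have hsrc := (chartAt (Model n) d).open_source.measurableSet
  have hμ : (volumeMeasure g.inner).restrict (chartAt (Model n) d).source
      = (chartMeasure g.inner (chartAt (Model n) d)).restrict (chartAt (Model n) d).source := by
    ext t ht
    rw [Measure.restrict_apply ht, Measure.restrict_apply ht]
    exact volumeMeasure_apply_of_subset g d (ht.inter hsrc) Set.inter_subset_right
  rw [← integral_chartMeasure g (chart_mem_atlas _ _) hh,
    ← setIntegral_eq_integral_of_forall_compl_eq_zero h0, hμ,
    setIntegral_eq_integral_of_forall_compl_eq_zero h0]

theorem isFiniteMeasure_volumeMeasure : IsFiniteMeasure (volumeMeasure g.inner) := by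
  obtain ⟨S, hS, -⟩ := exists_finset_chartPartition n M
  refine ⟨?_⟩
  rw [volumeMeasure_eq_sum g hS, Measure.finsetSum_apply]
  refine ENNReal.sum_lt_top.2 fun c _ => ?_
  rw [volumePiece, map_withDensity_symm_apply _ _ MeasurableSet.univ, Set.preimage_univ,
    Set.univ_inter]
  set e := chartAt (Model n) c
  have he : e ∈ atlas (Model n) M := chart_mem_atlas _ _
  have hsub : tsupport (chartPartition n M c) ⊆ e.source := chartPartition_isSubordinate n M c
  have hK : IsCompact (e '' tsupport (chartPartition n M c)) :=
    (isClosed_tsupport _).isCompact.image_of_continuousOn (e.continuousOn.mono hsub)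
  have hKt : e '' tsupport (chartPartition n M c) ⊆ e.target := by
    rintro _ ⟨x, hx, rfl⟩
    exact e.map_source (hsub hx)
  have hcont : ContinuousOn (fun y => chartPartition n M c (e.symm y) * density g.inner e y)
      e.target :=
    ((chartPartition n M c).contMDiff.continuous.comp_continuousOn e.continuousOn_symm).mul
      (continuousOn_density g he)
  have hint : IntegrableOn (fun y => chartPartition n M c (e.symm y) * density g.inner e y)
      e.target := by
    refine ((hcont.mono hKt).integrableOn_compact hK).of_forall_sdiff_eq_zero
      e.open_target.measurableSet fun y hy => ?_
    have h : e.symm y ∉ tsupport (chartPartition n M c) := fun h =>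
      hy.2 ⟨e.symm y, h, e.right_inv hy.1⟩
    rw [image_eq_zero_of_notMem_tsupport h, zero_mul]
  exact hint.lintegral_lt_top

theorem isOpenPosMeasure_volumeMeasure : (volumeMeasure g.inner).IsOpenPosMeasure := by
  refine ⟨fun U hU hne => ?_⟩
  obtain ⟨x, hx⟩ := hne
  have hopen := hU.inter (chartAt (Model n) x).open_source
  have hpos := chartMeasure_pos g (chart_mem_atlas _ x) hopen Set.inter_subset_right
    ⟨x, hx, mem_chart_source _ x⟩
  rw [← volumeMeasure_apply_of_subset g x hopen.measurableSet Set.inter_subset_right] at hpos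
  exact (hpos.trans_le (measure_mono Set.inter_subset_left)).ne'

end VolumeMeasure

/-! ### Inner products of forms and the global integration by parts -/

section FormInner

variable {n : ℕ} {M : Type*} [TopologicalSpace M] [ChartedSpace (Model n) M]

/-- The full contraction `⟨α, β⟩` of two forms at a point, in the preferred chart; it polarizes
`formSq`. -/
noncomputable def formInner {k : ℕ} (g : BilinField n M) (α β : FormField n M k) (x : M) : ℝ :=
  contract (inverseCoord g (chartAt (Model n) x) (chartAt (Model n) x x))
    (comps (formRep (chartAt (Model n) x) α (chartAt (Model n) x x)))
    (comps (formRep (chartAt (Model n) x) β (chartAt (Model n) x x)))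

theorem formSq_eq_formInner {k : ℕ} (g : BilinField n M) (α : FormField n M k) (x : M) :
    formSq g α x = formInner g α α x :=
  rfl

theorem formRep_smul {k : ℕ} (ρ : M → ℝ) (α : FormField n M k)
    (e : OpenPartialHomeomorph M (Model n)) (y : Model n) :
    formRep e (fun x => ρ x • α x) y = ρ (e.symm y) • formRep e α y :=
  rfl

theorem continuous_of_forall_comp_symm {h : M → ℝ}
    (hh : ∀ e ∈ atlas (Model n) M, ContinuousOn (fun y => h (e.symm y)) e.target) :
    Continuous h := by
  refine continuous_iff_continuousAt.2 fun x => ?_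
  let e := chartAt (Model n) x
  have hx : x ∈ e.source := mem_chart_source _ x
  have h1 : ContinuousAt ((fun y => h (e.symm y)) ∘ e) x :=
    ((hh e (chart_mem_atlas _ x)).continuousAt (e.open_target.mem_nhds (e.map_source hx))).comp
      (e.continuousAt hx)
  refine h1.congr ?_
  filter_upwards [e.open_source.mem_nhds hx] with z hz
  simp only [Function.comp_apply, e.left_inv hz]

variable [IsManifold (𝓡 n) ∞ M] {e : OpenPartialHomeomorph M (Model n)} {y : Model n}

theorem contDiffOn_comp_symm {ρ : M → ℝ} (hρ : ContMDiff (𝓡 n) 𝓘(ℝ, ℝ) ∞ ρ)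
    (he : e ∈ atlas (Model n) M) : ContDiffOn ℝ ∞ (fun y => ρ (e.symm y)) e.target := by
  rw [← contMDiffOn_iff_contDiffOn]
  exact hρ.comp_contMDiffOn
    (contMDiffOn_symm_of_mem_maximalAtlas (IsManifold.subset_maximalAtlas he))

theorem IsSmoothForm.smul {k : ℕ} {α : FormField n M k} (hα : IsSmoothForm α) {ρ : M → ℝ}
    (hρ : ContMDiff (𝓡 n) 𝓘(ℝ, ℝ) ∞ ρ) : IsSmoothForm (fun x => ρ x • α x) :=
  fun e he => (contDiffOn_comp_symm hρ he).smul (hα e he)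

theorem IsSmoothForm.extD {k : ℕ} {α : FormField n M k} (hα : IsSmoothForm α) :
    IsSmoothForm (extD α) :=
  fun _ he => contDiffOn_formRep_extD hα he

theorem extDeriv_sum {k : ℕ} {ι : Type*} {S : Finset ι}
    {η : ι → Model n → Model n [⋀^Fin k]→L[ℝ] ℝ}
    (h : ∀ c ∈ S, DifferentiableAt ℝ (η c) y) :
    extDeriv (fun z => ∑ c ∈ S, η c z) y = ∑ c ∈ S, extDeriv (η c) y := by
  have h1 := map_sum (ContinuousAlternatingMap.alternatizeUncurryFinCLM (n := k) ℝ (Model n) ℝ)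
    (fun c => fderiv ℝ (η c) y) S
  rw [← fderiv_fun_sum h] at h1
  exact h1

theorem eq_zero_of_formRep_eq_zero {k : ℕ} {α : FormField n M k} (he : e ∈ atlas (Model n) M)
    {x : M} (hx : x ∈ e.source) (h : formRep e α (e x) = 0) : α x = 0 := by
  let α' : M → Model n [⋀^Fin k]→L[ℝ] ℝ := α
  have hsurj : Function.Surjective (symmDeriv e (e x)) :=
    (LinearMap.injective_iff_surjective
      (f := (symmDeriv e (e x) : Model n →ₗ[ℝ] Model n))).1
      (symmDeriv_injective he (e.map_source hx))
  change α' x = 0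
  ext v
  choose w hw using fun s => hsurj (v s)
  have h1 : α' (e.symm (e x)) (fun s => symmDeriv e (e x) (w s)) = 0 :=
    congrArg (fun L => L w) h
  rw [e.left_inv hx] at h1
  simp only [hw] at h1
  exact h1

variable (g : RMetric n M)

theorem formInner_symm {k : ℕ} (α β : FormField n M k) (he : e ∈ atlas (Model n) M)
    (hy : y ∈ e.target) :
    formInner g.inner α β (e.symm y)
      = contract (inverseCoord g.inner e y) (comps (formRep e α y)) (comps (formRep e β y)) :=
  (contract_change g α β he (chart_mem_atlas _ _) hy (mem_chart_source _ _)).symm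

theorem continuous_formInner {k : ℕ} {α β : FormField n M k} (hα : IsSmoothForm α)
    (hβ : IsSmoothForm β) : Continuous (formInner g.inner α β) := by
  refine continuous_of_forall_comp_symm (n := n) fun e he => ?_
  have hP : ∀ i j, ContinuousOn (fun y => inverseCoord g.inner e y i j) e.target :=
    fun i j y hy => (contDiffAt_inverseCoord (r := ∞) (fun i j =>
      (contDiffOn_metricCoord g he i j).contDiffAt (e.open_target.mem_nhds hy))
        (metricCoord_posDef g he hy).det_pos i j).continuousAt.continuousWithinAt
  have h : ContinuousOn (fun y => contract (inverseCoord g.inner e y) (comps (formRep e α y))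
      (comps (formRep e β y))) e.target :=
    continuousOn_finsetSum _ fun a _ => continuousOn_finsetSum _ fun b _ =>
    (continuousOn_finsetProd _ fun s _ => hP _ _).mul
      ((contDiffOn_comps (hα e he) a).continuousOn.mul (contDiffOn_comps (hβ e he) b).continuousOn)
  exact h.congr fun y hy => formInner_symm g α β he hy

theorem formInner_self_nonneg {k : ℕ} (α : FormField n M k) (x : M) :
    0 ≤ formInner g.inner α α x :=
  contract_self_nonneg (inverseCoord_posDef g (chart_mem_atlas _ x) (mem_chart_target _ x)) _

theorem eq_zero_of_formInner_self {k : ℕ} {α : FormField n M k} {x : M}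
    (h : formInner g.inner α α x = 0) : α x = 0 :=
  eq_zero_of_formRep_eq_zero (chart_mem_atlas _ x) (mem_chart_source _ x)
    (eq_zero_of_comps_eq_zero (eq_zero_of_contract_self
      (inverseCoord_posDef g (chart_mem_atlas _ x) (mem_chart_target _ x)) h))

variable [CompactSpace M] [T2Space M]

/-- `dα` is the sum of the exterior derivatives of the pieces of `α` cut out by the partition of
unity. -/
theorem formInner_extD_eq_sum {k : ℕ} (α : FormField n M (k + 1)) {β : FormField n M k}
    (hβ : IsSmoothForm β) {S : Finset M} (hS : ∀ x, ∑ c ∈ S, chartPartition n M c x = 1) (x : M) :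
    formInner g.inner α (extD β) x
      = ∑ c ∈ S, formInner g.inner α (extD fun z => chartPartition n M c z • β z) x := by
  let e := chartAt (Model n) x
  have he : e ∈ atlas (Model n) M := chart_mem_atlas _ x
  have hx : e x ∈ e.target := mem_chart_target _ x
  have hsm : ∀ c, IsSmoothForm (fun z => chartPartition n M c z • β z) := fun c =>
    hβ.smul (chartPartition n M c).contMDiff
  have hsum : formRep e β
      = fun y => ∑ c ∈ S, formRep e (fun z => chartPartition n M c z • β z) y := by
    funext y
    simp only [formRep_smul, ← Finset.sum_smul, hS, one_smul]
  have h1 : comps (formRep e (extD β) (e x)) = fun b => ∑ c ∈ S,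
      comps (formRep e (extD fun z => chartPartition n M c z • β z) (e x)) b := by
    rw [formRep_extD hβ he hx, hsum, extDeriv_sum fun c _ =>
      ((hsm c e he).contDiffAt (e.open_target.mem_nhds hx)).differentiableAt (by simp)]
    funext b
    simp only [comps, ContinuousAlternatingMap.sum_apply, formRep_extD (hsm _) he hx]
  rw [formInner, h1, contract_sum_right]
  rfl

variable [MeasurableSpace M] [BorelSpace M]

/-- A smooth form whose weighted `L²` norm vanishes is zero. -/
theorem eq_zero_of_integral_formSq {k : ℕ} {f : M → ℝ} (hf : Continuous f) {α : FormField n M k}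
    (hα : IsSmoothForm α)
    (h : ∫ x, Real.exp (-f x) * formSq g.inner α x ∂(volumeMeasure g.inner) = 0) (x : M) :
    α x = 0 := by
  have := isFiniteMeasure_volumeMeasure g
  have := isOpenPosMeasure_volumeMeasure g
  have hc : Continuous fun x => Real.exp (-f x) * formSq g.inner α x :=
    (Real.continuous_exp.comp hf.neg).mul (continuous_formInner g hα hα)
  have hn : 0 ≤ fun x => Real.exp (-f x) * formSq g.inner α x := fun x =>
    mul_nonneg (Real.exp_pos _).le (formInner_self_nonneg g α x)
  have hi : Integrable (fun x => Real.exp (-f x) * formSq g.inner α x) (volumeMeasure g.inner) :=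
    hc.integrable_of_hasCompactSupport (HasCompactSupport.of_compactSpace _)
  have h0 := (hc.ae_eq_iff_eq (volumeMeasure g.inner) continuous_const).1
    ((integral_eq_zero_iff_of_nonneg hn hi).1 h)
  have hx : Real.exp (-f x) * formSq g.inner α x = 0 := congrFun h0 x
  exact eq_zero_of_formInner_self g ((mul_eq_zero.1 hx).resolve_left (Real.exp_pos _).ne')

/-- If the weighted divergence of `dα` vanishes then `∫ e^{-f} |dα|² dV = 0`: each piece `ρ α` of
`α` is compactly supported in one chart, where `dα` is orthogonal to `d(ρ α)`. -/
theorem integral_formSq_extD_eq_zero {m : ℕ} {f : M → ℝ} (hf : ContMDiff (𝓡 n) 𝓘(ℝ, ℝ) ∞ f)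
    {α : FormField n M m} (hα : IsSmoothForm α)
    (hdiv : ∀ e ∈ atlas (Model n) M, ∀ y ∈ e.target, ∀ b, covDiv g.inner e
      (weighted g.inner e (fun z => Real.exp (-f (e.symm z))) (formRep e (extD α))) b y = 0) :
    ∫ x, Real.exp (-f x) * formSq g.inner (extD α) x ∂(volumeMeasure g.inner) = 0 := by
  have := isFiniteMeasure_volumeMeasure g
  obtain ⟨S, -, hS⟩ := exists_finset_chartPartition n M
  have hsm : ∀ c, IsSmoothForm (fun z => chartPartition n M c z • α z) := fun c =>
    hα.smul (chartPartition n M c).contMDiff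
  have hc : ∀ c, Continuous fun x => Real.exp (-f x)
      * formInner g.inner (extD α) (extD fun z => chartPartition n M c z • α z) x := fun c =>
    (Real.continuous_exp.comp hf.continuous.neg).mul (continuous_formInner g hα.extD (hsm c).extD)
  simp only [formSq_eq_formInner, formInner_extD_eq_sum g (extD α) hα hS, Finset.mul_sum]
  rw [integral_finsetSum _ fun c _ =>
    (hc c).integrable_of_hasCompactSupport (HasCompactSupport.of_compactSpace _)]
  refine Finset.sum_eq_zero fun c _ => ?_
  let e := chartAt (Model n) c
  have he : e ∈ atlas (Model n) M := chart_mem_atlas _ c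
  have hsub : tsupport (chartPartition n M c) ⊆ e.source := chartPartition_isSubordinate n M c
  have hK : IsCompact (e '' tsupport (chartPartition n M c)) :=
    (isClosed_tsupport _).isCompact.image_of_continuousOn (e.continuousOn.mono hsub)
  have hKt : e '' tsupport (chartPartition n M c) ⊆ e.target := by
    rintro _ ⟨x, hx, rfl⟩
    exact e.map_source (hsub hx)
  -- outside the support of `ρ` the form `d(ρ α)` vanishes
  have h0 : ∀ x ∉ e.source, Real.exp (-f x)
      * formInner g.inner (extD α) (extD fun z => chartPartition n M c z • α z) x = 0 := by
    intro x hx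
    let e' := chartAt (Model n) x
    have he' : e' ∈ atlas (Model n) M := chart_mem_atlas _ x
    have hxt : e' x ∈ e'.target := mem_chart_target _ x
    have hx' : e'.symm (e' x) = x := e'.left_inv (mem_chart_source _ x)
    have hnhds : ∀ᶠ z in nhds (e' x), e'.symm z ∉ tsupport (chartPartition n M c) := by
      have hmem : (tsupport (chartPartition n M c))ᶜ ∈ nhds (e'.symm (e' x)) := by
        rw [hx']
        exact (isClosed_tsupport _).isOpen_compl.mem_nhds fun h => hx (hsub h)
      exact (e'.continuousAt_symm hxt).eventually hmem
    have hev : formRep e' (fun z => chartPartition n M c z • α z) =ᶠ[nhds (e' x)] fun _ => 0 := by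
      filter_upwards [hnhds] with z hz
      rw [formRep_smul, image_eq_zero_of_notMem_tsupport hz, zero_smul]
    have hd : formRep e' (extD fun z => chartPartition n M c z • α z) (e' x) = 0 := by
      rw [formRep_extD (hsm c) he' hxt, hev.extDeriv_eq, extDeriv, fderiv_fun_const]
      exact map_zero (ContinuousAlternatingMap.alternatizeUncurryFinCLM (n := m) ℝ (Model n) ℝ)
    have hz : formInner g.inner (extD α) (extD fun z => chartPartition n M c z • α z) x = 0 := by
      rw [formInner, hd]
      exact contract_zero_right _ _
    rw [hz, mul_zero]
  have hIBP := setIntegral_contract_extDeriv_eq_zero (g := g.inner) (e := e)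
    (metricCoord_isSymm g e)
    (fun i j => (contDiffOn_metricCoord g he i j).of_le (by simp))
    (fun z hz => (metricCoord_posDef g he hz).det_pos)
    (u := fun z => Real.exp (-f (e.symm z)))
    (((contDiffOn_comp_symm hf he).neg.exp).of_le (by simp))
    ((hα.extD e he).of_le (by simp)) (hdiv e he)
    ((hsm c e he).of_le (by simp)) hK hKt
    (fun z hz hzK => by
      have h : e.symm z ∉ tsupport (chartPartition n M c) := fun h =>
        hzK ⟨e.symm z, h, e.right_inv hz⟩
      rw [formRep_smul, image_eq_zero_of_notMem_tsupport h, zero_smul])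
  rw [integral_volumeMeasure_eq g c (hc c) h0, ← hIBP]
  refine setIntegral_congr_fun e.open_target.measurableSet fun y hy => ?_
  change density g.inner e y * (Real.exp (-f (e.symm y))
      * formInner g.inner (extD α) (extD fun z => chartPartition n M c z • α z) (e.symm y)) = _
  rw [formInner_symm g _ _ he hy, formRep_extD (hsm c) he hy, density]

end FormInner

/-! ### Vanishing of the field strengths -/

section Conclusions

variable {n : ℕ} {M : Type*} [TopologicalSpace M] [ChartedSpace (Model n) M]

theorem equationF_of_eq_zero {g : BilinField n M} {f : M → ℝ} {F : FormField n M 2}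
    (h : ∀ x, F x = 0) : EquationF g f F := by
  intro e _ y _ i
  have hw : weightedF g f F e = fun _ _ _ => 0 := by
    funext i k z
    simp [weightedF, formCoord, h]
  simp [divF, hw, pd_const]

theorem equationH_of_eq_zero {g : BilinField n M} {f : M → ℝ} {H : FormField n M 3}
    (h : ∀ x, H x = 0) : EquationH g f H := by
  intro e _ y _ i j
  have hw : weightedH g f H e = fun _ _ _ _ => 0 := by
    funext k i j z
    simp [weightedH, formCoord, h]
  simp [divH, hw, pd_const]

theorem isSmoothForm_zero (k : ℕ) : IsSmoothForm (fun _ => 0 : FormField n M k) :=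
  fun e _ => (contDiffOn_const (c := (0 : Model n [⋀^Fin k]→L[ℝ] ℝ))).congr
    fun _ _ => show formRep e (fun _ => 0 : FormField n M k) _ = 0 from rfl

theorem extD_smul {k : ℕ} (c : ℝ) (α : FormField n M k) :
    extD (fun x => c • α x) = fun x => c • extD α x := by
  funext x
  have h : formRep (chartAt (Model n) x) (fun x => c • α x)
      = c • formRep (chartAt (Model n) x) α := rfl
  simp only [extD, h, extDeriv_smul]
  rfl

theorem add_smul_zero_bilinField (g : BilinField n M) (t : ℝ) :
    (fun x => g x + t • (0 : TangentSpace (𝓡 n) x →L[ℝ] TangentSpace (𝓡 n) x →L[ℝ] ℝ)) = g := by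
  funext x
  ext v w
  change g x v w + t * 0 = g x v w
  ring

theorem add_smul_self {k : ℕ} (α : FormField n M k) (t : ℝ) :
    (fun x => α x + t • α x) = fun x => (1 + t) • α x := by
  funext x
  rw [add_smul, one_smul]

theorem formSq_smul {k : ℕ} (g : BilinField n M) (c : ℝ) (α : FormField n M k) (x : M) :
    formSq g (fun x => c • α x) x = c ^ 2 * formSq g α x := by
  have h : ∀ e y a, formCoord (fun x => c • α x) e y a = c * formCoord α e y a :=
    fun _ _ _ => rfl
  simp only [formSq, h, Finset.mul_sum]
  exact Finset.sum_congr rfl fun a _ => Finset.sum_congr rfl fun b _ => by ring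

theorem eq_zero_of_hasDerivAt_quadratic {φ : ℝ → ℝ} {C q K : ℝ} (hq : q ≠ 0)
    (hφ : ∀ t, φ t = C - q * ((1 + t) ^ 2 * K)) (h : HasDerivAt φ 0 0) : K = 0 := by
  have h1 : HasDerivAt φ (-(q * (2 * K))) 0 := by
    have h2 := ((((hasDerivAt_id (0 : ℝ)).const_add 1).pow 2).mul_const K).const_mul q
    rw [funext hφ]
    exact (h2.const_sub C).congr_deriv (by simp)
  have h3 := h.unique h1
  have h4 : q * (2 * K) = 0 := by linarith
  simpa [hq] using h4

variable [IsManifold (𝓡 n) ∞ M]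

set_option synthInstance.maxHeartbeats 400000 in
theorem contMDiff_zero_bilinField :
    ContMDiff (𝓡 n) ((𝓡 n).prod 𝓘(ℝ, Model n →L[ℝ] Model n →L[ℝ] ℝ)) ∞
      (fun x : M => TotalSpace.mk' (Model n →L[ℝ] Model n →L[ℝ] ℝ)
        (E := fun x : M => TangentSpace (𝓡 n) x →L[ℝ] TangentSpace (𝓡 n) x →L[ℝ] ℝ) x 0) :=
  Bundle.contMDiff_zeroSection ℝ
    (fun x : M => TangentSpace (𝓡 n) x →L[ℝ] TangentSpace (𝓡 n) x →L[ℝ] ℝ)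

variable [CompactSpace M] [T2Space M] [MeasurableSpace M]

theorem integral_formSq_smul (g : BilinField n M) (f : M → ℝ) {k : ℕ} (c : ℝ)
    (α : FormField n M k) :
    ∫ x, Real.exp (-f x) * formSq g (extD fun x => c • α x) x ∂(volumeMeasure g)
      = c ^ 2 * ∫ x, Real.exp (-f x) * formSq g (extD α) x ∂(volumeMeasure g) := by
  rw [← integral_const_mul, extD_smul]
  simp only [formSq_smul]
  exact integral_congr_ae (Filter.Eventually.of_forall fun x => by ring)

/-- Scaling the potential `A` scales `∫ e^{-f} F² dV` quadratically and leaves the other terms of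
the action unchanged, so this integral vanishes at a critical point. -/
theorem integral_formSq_extD_eq_zero_of_isCritical_one {χ : ℝ} {g : BilinField n M} {f : M → ℝ}
    {A : FormField n M 1} {B : FormField n M 2} (hA : IsSmoothForm A) (h : IsCritical χ g f A B) :
    ∫ x, Real.exp (-f x) * formSq g (extD A) x ∂(volumeMeasure g) = 0 := by
  have h1 := h (fun _ => 0) (fun _ => 0) A (fun _ => 0) (fun _ _ _ => rfl)
    contMDiff_zero_bilinField contMDiff_const hA (isSmoothForm_zero 2)
  simp only [add_smul_zero_bilinField] at h1
  simp only [smul_zero, add_zero, mul_zero, add_smul_self, action,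
    integral_formSq_smul] at h1
  exact eq_zero_of_hasDerivAt_quadratic (by norm_num) (fun _ => rfl) h1

/-- The same for the potential `B` and `∫ e^{-f} H² dV`. -/
theorem integral_formSq_extD_eq_zero_of_isCritical_two {χ : ℝ} {g : BilinField n M} {f : M → ℝ}
    {A : FormField n M 1} {B : FormField n M 2} (hB : IsSmoothForm B) (h : IsCritical χ g f A B) :
    ∫ x, Real.exp (-f x) * formSq g (extD B) x ∂(volumeMeasure g) = 0 := by
  have h1 := h (fun _ => 0) (fun _ => 0) (fun _ => 0) B (fun _ _ _ => rfl)
    contMDiff_zero_bilinField contMDiff_const (isSmoothForm_zero 1) hB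
  simp only [add_smul_zero_bilinField] at h1
  simp only [smul_zero, add_zero, mul_zero, add_smul_self, action,
    integral_formSq_smul] at h1
  exact eq_zero_of_hasDerivAt_quadratic (by norm_num) (fun _ => sub_right_comm _ _ _) h1

variable [BorelSpace M]

theorem extD_eq_zero_of_equationF (g : RMetric n M) {f : M → ℝ}
    (hf : ContMDiff (𝓡 n) 𝓘(ℝ, ℝ) ∞ f) {A : FormField n M 1} (hA : IsSmoothForm A)
    (h : EquationF g.inner f (extD A)) (x : M) : extD A x = 0 := by
  refine eq_zero_of_integral_formSq g hf.continuous hA.extD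
    (integral_formSq_extD_eq_zero g hf hA fun e he y hy b => ?_) x
  have hb : b = ![b 0] := by
    funext s; fin_cases s; rfl
  have h1 := h e he y hy (b 0)
  rw [divF_eq, ← hb] at h1
  exact neg_eq_zero.1 h1

theorem extD_eq_zero_of_equationH (g : RMetric n M) {f : M → ℝ}
    (hf : ContMDiff (𝓡 n) 𝓘(ℝ, ℝ) ∞ f) {B : FormField n M 2} (hB : IsSmoothForm B)
    (h : EquationH g.inner f (extD B)) (x : M) : extD B x = 0 := by
  refine eq_zero_of_integral_formSq g hf.continuous hB.extD
    (integral_formSq_extD_eq_zero g hf hB fun e he y hy b => ?_) x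
  have hb : b = ![b 0, b 1] := by
    funext s; fin_cases s <;> rfl
  have h1 := h e he y hy (b 0) (b 1)
  rwa [divH_eq, ← hb] at h1

end Conclusions

end SigmaModel

theorem mainTheorem3 (n : ℕ) (M : Type*) [TopologicalSpace M] [T2Space M] [CompactSpace M]
    [ChartedSpace (Model n) M] [IsManifold (𝓡 n) ∞ M] [MeasurableSpace M] [BorelSpace M]
    (g : RMetric n M) (f : M → ℝ) (hf : ContMDiff (𝓡 n) 𝓘(ℝ, ℝ) ∞ f)
    (A : FormField n M 1) (hA : IsSmoothForm A) (B : FormField n M 2) (hB : IsSmoothForm B) :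
    (EquationF g.inner f (extD A) → ∀ x, extD A x = 0) ∧
    (EquationH g.inner f (extD B) → ∀ x, extD B x = 0) ∧
    (∀ χ : ℝ, IsCritical χ g.inner f A B →
      EquationF g.inner f (extD A) ∧ EquationH g.inner f (extD B) ∧
      (∀ x, extD A x = 0) ∧ (∀ x, extD B x = 0)) := by
  refine ⟨extD_eq_zero_of_equationF g hf hA, extD_eq_zero_of_equationH g hf hB, fun χ h => ?_⟩
  have hF := eq_zero_of_integral_formSq g hf.continuous hA.extD
    (integral_formSq_extD_eq_zero_of_isCritical_one hA h)
  have hH := eq_zero_of_integral_formSq g hf.continuous hB.extD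
    (integral_formSq_extD_eq_zero_of_isCritical_two hB h)
  exact ⟨equationF_of_eq_zero hF, equationH_of_eq_zero hH, hF, hH⟩
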